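/- Let $U\subseteq\mathbb R^2$ be open and connected, with coordinates $u=(u^1,u^2)$, and consider operators $$P_1=g^{ij}(u)\,\partial_x+\Gamma^{ij}_k(u)\,u^k_x ,\qquad R_2=\begin{pmatrix}0&1\\-1&0\end{pmatrix}\partial_x^2 ,$$ where $g^{ij},\Gamma^{ij}_k$ $(i,j,k\in\{1,2\})$ are smooth real functions on $U$. A matrix differential operator $P$ is called Hamiltonian if $\{F,G\}=\int\frac{\delta F}{\delta u^i}P^{ij}\frac{\delta G}{\delta u^j}\,dx$ is skew-symmetric and satisfies the Jacobi identity on all local functionals $F=\int f(x,u,u_x,\dots,u_{(n)})\,dx$ (densities modulo total $x$-derivatives), and two operators are called compatible if all their linear combinations with constant real coefficients are Hamiltonian. Consider the conditions $$g^{11}=c_1u^1+c_2,\qquad g^{12}=g^{21}=\tfrac12c_3u^1+\tfrac12c_1u^2+c_5,\qquad g^{22}=c_3u^2+c_4\qquad(\ast)$$ on $U$, with real constants $c_1,\dots,c_5$. (i) For arbitrary (possibly degenerate) smooth $g^{ij}$, there exist smooth $\Gamma^{ij}_k$ such that $P_1$ is Hamiltonian and compatible with $R_2$ if and only if $(\ast)$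 holds for some constants $c_1,\dots,c_5$. (ii) If $\det(g^{ij})\neq0$ everywhere on $U$, then $P_1$, with given $g^{ij}$ and $\Gamma^{ij}_k$, is Hamiltonian and compatible with $R_2$ if and only if $(\ast)$ holds for some constants $c_1,\dots,c_5$ and $\Gamma^{ij}_k=-g^{il}\Gamma^j_{lk}$, where $\Gamma^j_{lk}$ are the Christoffel symbols of the Levi-Civita connection of the metric $(g_{ij})=(g^{ij})^{-1}$. (iii) For all values of $c_1,\dots,c_5$ the metric $(g_{ij})=(g^{ij})^{-1}$ given by $(\ast)$ is flat, i.e. its Riemann curvature tensor vanishes at every point of $\mathbb R^2$ where $\det(g^{ij})\neq0$. -/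

import Mathlib

open scoped ContDiff

noncomputable section

namespace LocalPoisson

/-! ## Formal calculus of variations for two dependent variables `u = (u^1, u^2)` of `x` -/

/-- A point `(x, (u^i_{(k)}))` of the infinite jet space: `p.1` is `x` and `p.2 (k, i)` is the `k`-th
`x`-derivative of the `i`-th dependent variable. -/
abbrev Jet : Type := ℝ × (ℕ × Fin 2 → ℝ)

/-- The value `(u^1, u^2)` of the dependent variables at a jet. -/
def Jet.val (p : Jet) : Fin 2 → ℝ := fun i => p.2 (0, i)

/-- Real functions of the jet variables. -/
abbrev JetFun : Type := Jet → ℝ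

/-- `f` is a differential function over `U`: on the jets with `u ∈ U` it is a smooth
function of `x` and of finitely many of the `u^i_{(k)}`. -/
def IsDensity (U : Set (Fin 2 → ℝ)) (f : JetFun) : Prop :=
  ∃ (n : ℕ) (F : ℝ × (Fin (n + 1) × Fin 2 → ℝ) → ℝ),
    ContDiffOn ℝ ∞ F {q | (fun i => q.2 (0, i)) ∈ U} ∧
    ∀ p : Jet, p.val ∈ U → f p = F (p.1, fun a => p.2 (a.1, a.2))

/-- The partial derivative `∂f/∂x`. -/
def pdx (f : JetFun) : JetFun := fun p => lineDeriv ℝ f p (1, 0)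

/-- The partial derivative `∂f/∂u^i_{(k)}`. -/
def pd (k : ℕ) (i : Fin 2) (f : JetFun) : JetFun :=
  fun p => lineDeriv ℝ f p (0, Pi.single (k, i) 1)

/-- The total derivative `∂_x f = ∂f/∂x + ∑ u^i_{(k+1)} ∂f/∂u^i_{(k)}`
(a finite sum for differential functions). -/
def totalD (f : JetFun) : JetFun :=
  fun p => pdx f p + ∑ᶠ a : ℕ × Fin 2, pd a.1 a.2 f p * p.2 (a.1 + 1, a.2)

/-- The variational derivative `δ/δu^i ∫ f dx = ∑_k (-∂_x)^k (∂f/∂u^i_{(k)})`. -/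
def varDeriv (f : JetFun) (i : Fin 2) : JetFun :=
  fun p => ∑ᶠ k : ℕ, (-1) ^ k * (totalD^[k] (pd k i f)) p

/-- `∫ f dx` is the zero local functional: `f` is a total derivative over `U`. -/
def IsNullFunctional (U : Set (Fin 2 → ℝ)) (f : JetFun) : Prop :=
  ∃ h : JetFun, IsDensity U h ∧ ∀ p : Jet, p.val ∈ U → f p = totalD h p

/-! ## Matrix differential operators and the bracket they define -/

/-- A matrix differential operator `∑_l A_l ∂_x^l`, given by its coefficients
`l ↦ A_l`, which are matrices of functions on the jet space. -/
abbrev MatDiffOp : Type := ℕ →₀ Matrix (Fin 2) (Fin 2) JetFun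

/-- The action `(P ψ)^i = ∑_l ∑_j A_l^{ij} ∂_x^l ψ_j`. -/
def MatDiffOp.act (P : MatDiffOp) (ψ : Fin 2 → JetFun) (i : Fin 2) : JetFun :=
  P.sum fun l A => ∑ j, A i j * totalD^[l] (ψ j)

/-- The density of the bracket
`{∫ f dx, ∫ g dx} = ∫ (δf/δu^i) P^{ij} (δg/δu^j) dx`. -/
def bracket (P : MatDiffOp) (f g : JetFun) : JetFun :=
  ∑ i, varDeriv f i * P.act (varDeriv g) i

/-- `P` is a Hamiltonian operator over `U`: its bracket is a Poisson bracket, i.e. it is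
skew-symmetric and satisfies the Jacobi identity, on the local functionals `∫ f dx`. -/
def IsHamiltonian (U : Set (Fin 2 → ℝ)) (P : MatDiffOp) : Prop :=
  (∀ f g : JetFun, IsDensity U f → IsDensity U g →
    IsNullFunctional U (bracket P f g + bracket P g f)) ∧
  (∀ f g h : JetFun, IsDensity U f → IsDensity U g → IsDensity U h →
    IsNullFunctional U
      (bracket P (bracket P f g) h + bracket P (bracket P g h) f + bracket P (bracket P h f) g))

/-- `P` and `Q` are compatible: all their linear combinations are Hamiltonian. -/
def Compatible (U : Set (Fin 2 → ℝ)) (P Q : MatDiffOp) : Prop :=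
  ∀ a b : ℝ, IsHamiltonian U (a • P + b • Q)

/-- The first-order operator of hydrodynamic type `g^{ij}(u) ∂_x + Γ^{ij}_k(u) u^k_x`;
`Γ u i j k` is `Γ^{ij}_k(u)`. -/
def hydroOp (g : (Fin 2 → ℝ) → Matrix (Fin 2) (Fin 2) ℝ)
    (Γ : (Fin 2 → ℝ) → Fin 2 → Fin 2 → Fin 2 → ℝ) : MatDiffOp :=
  Finsupp.single 1 (Matrix.of fun i j p => g p.val i j) +
  Finsupp.single 0 (Matrix.of fun i j p => ∑ k, Γ p.val i j k * p.2 (1, k))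

/-- The second-order operator `[[0, 1], [-1, 0]] ∂_x^2`. -/
def R2 : MatDiffOp := Finsupp.single 2 !![0, 1; -1, 0]

/-! ## Contravariant metrics -/

/-- The partial derivative `∂f/∂u^k` of a function of `u = (u^1, u^2)`. -/
def partialU (k : Fin 2) (f : (Fin 2 → ℝ) → ℝ) (u : Fin 2 → ℝ) : ℝ :=
  lineDeriv ℝ f u (Pi.single k 1)

/-- The Christoffel symbols `Γ^i_{jk}` of the Levi-Civita connection of the covariant metric
`g_{ij} = (g^{ij})⁻¹` (meaningful where `det g^{ij} ≠ 0`). -/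
def christoffel (g : (Fin 2 → ℝ) → Matrix (Fin 2) (Fin 2) ℝ) (i j k : Fin 2)
    (u : Fin 2 → ℝ) : ℝ :=
  (1 / 2) * ∑ s, g u i s *
    (partialU j (fun v => (g v)⁻¹ s k) u + partialU k (fun v => (g v)⁻¹ s j) u
      - partialU s (fun v => (g v)⁻¹ j k) u)

/-- The contravariant Christoffel symbols `Γ^{ij}_k = -g^{il} Γ^j_{lk}`. -/
def contraChristoffel (g : (Fin 2 → ℝ) → Matrix (Fin 2) (Fin 2) ℝ) (u : Fin 2 → ℝ)
    (i j k : Fin 2) : ℝ :=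
  -∑ l, g u i l * christoffel g j l k u

/-- The Riemann curvature tensor `R^i_{jkl}` of the covariant metric `(g^{ij})⁻¹`
(meaningful where `det g^{ij} ≠ 0`). -/
def curvature (g : (Fin 2 → ℝ) → Matrix (Fin 2) (Fin 2) ℝ) (i j k l : Fin 2)
    (u : Fin 2 → ℝ) : ℝ :=
  partialU k (christoffel g i l j) u - partialU l (christoffel g i k j) u
    + ∑ m, (christoffel g i k m u * christoffel g m l j u
      - christoffel g i l m u * christoffel g m k j u)

/-- The five-parameter family of contravariant metrics. -/
def familyMetric (c₁ c₂ c₃ c₄ c₅ : ℝ) (u : Fin 2 → ℝ) : Matrix (Fin 2) (Fin 2) ℝ :=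
  !![c₁ * u 0 + c₂, (1 / 2) * c₃ * u 0 + (1 / 2) * c₁ * u 1 + c₅;
     (1 / 2) * c₃ * u 0 + (1 / 2) * c₁ * u 1 + c₅, c₃ * u 1 + c₄]

end LocalPoisson

end

/-!
The proof separates algebra from analysis. A `JetCalculus` axiomatizes the ring of differential
functions with its partial derivatives; `diffCalculus U` realizes it by the functions on the jets
over `U`, and `RepOp.isHamiltonian_iff` turns `IsHamiltonian` into an identity modulo the image of
the total derivative `D` in this ring. A total derivative has vanishing variational derivative, but
the converse, which fails over a `U` with topology, is never used: nullity is always proved by an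
explicit potential.

Let `X_v` be the evolutionary field of `v`. It commutes with `D`, it satisfies
`X_v f ≡ ∑ v^i δf/δu^i` (`isNull_evol_sub`), and `[X_v, X_w] = X_{[v, w]}`. Together these give the
self-adjointness of second variations (`isNull_helmholtz`), and for a skew-adjoint operator `P` they
reduce the Jacobi identity to the vanishing of the cyclic sum of `∫ ψ · (X_{Pχ} P) φ dx` on
variational derivatives `ψ, φ, χ` (`isNull_jacobi_sub`).

Put `c = (c₁, c₃)`. The metrics of the family are `g^{ij} = (c^i u^j + c^j u^i) / 2 + η^{ij}` with a
constant symmetric `η`, and the connection belonging to them is `Γ^{ij}_k = δ^i_k c^j / 2`.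

*Sufficiency.* For these coefficients `P₁ + R₂` is linear in `u` up to constants: it is the
Lie-Poisson operator of the bracket `[ψ, φ] = ((c·ψ) φ' - (c·φ) ψ') / 2`, plus the cocycles `η D`
and `R₂` (`isPoisson_pencil`).

*Necessity.* The part of the Jacobi identity of `P₁ + R₂` which is linear in both operators is
tested on functionals with densities `a(x) u^i`, `γ(x) u^l` and `γ(x) (u^l)²`. The last ones are
needed because a function of `x` alone is a total derivative. This gives equations in the ring of differential functions (`jacobi_conditions`) which force the form of
`∂g` and of `Γ` and the constancy of `c` (`conditions_of_isPoisson`); connectedness of `U` then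
gives the family. Nondegeneracy of `g` is not used here.

*Geometry.* Where `g` is invertible, the Levi-Civita connection of the family is
`Γ^i_{jk} = -c^i g_{jk} / 2` (`christoffel_familyMetric`), whence both its contravariant form
`δ^i_k c^j / 2` and the vanishing of the curvature.
-/

noncomputable section

namespace LocalPoisson

/-! ### The algebraic calculus of variations -/

/-- The algebra of differential functions, axiomatized: a commutative `ℝ`-algebra with the commuting
partial derivatives `pdx = ∂/∂x` and `pd k i = ∂/∂u^i_{(k)}` and with the coordinates `x` and
`coord k i = u^i_{(k)}`, in which every element has finite order. By the last axiom an
element which vanishes on every hyperplane `x = r`, in the sense of divisibility by `x - r`, is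
zero. -/
structure JetCalculus (A : Type*) [CommRing A] [Algebra ℝ A] where
  pdx : Derivation ℝ A A
  pd : ℕ → Fin 2 → Derivation ℝ A A
  x : A
  coord : ℕ → Fin 2 → A
  exists_order : ∀ a : A, ∃ n : ℕ, ∀ k i, n ≤ k → pd k i a = 0
  pd_comm : ∀ k i l j a, pd k i (pd l j a) = pd l j (pd k i a)
  pd_pdx : ∀ k i a, pd k i (pdx a) = pdx (pd k i a)
  pd_x : ∀ k i, pd k i x = 0
  pdx_x : pdx x = 1
  pd_coord : ∀ k i l j, pd k i (coord l j) = if k = l ∧ i = j then 1 else 0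
  pdx_coord : ∀ l j, pdx (coord l j) = 0
  eq_zero_of_dvd : ∀ a : A, (∀ r : ℝ, (x - algebraMap ℝ A r) ∣ a) → a = 0

namespace JetCalculus

theorem finsum_eq_sum_range {A : Type*} [AddCommMonoid A] (F : ℕ → A) {n : ℕ}
    (hF : ∀ k, n ≤ k → F k = 0) :
    ∑ᶠ k, F k = ∑ k ∈ Finset.range n, F k := by
  apply finsum_eq_sum_of_support_subset
  intro k hk
  by_contra h
  exact hk (hF k (by simpa using h))

variable {A : Type*} [CommRing A] [Algebra ℝ A] (J : JetCalculus A)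

theorem sum_pd_eq_zero {a : A} {n : ℕ} (hn : ∀ k i, n ≤ k → J.pd k i a = 0)
    (c : ℕ → Fin 2 → A) (k : ℕ) (hk : n ≤ k) : ∑ i, c k i * J.pd k i a = 0 :=
  Finset.sum_eq_zero fun i _ => by rw [hn k i hk, mul_zero]

theorem exists_order₂ (a b : A) :
    ∃ n : ℕ, (∀ k i, n ≤ k → J.pd k i a = 0) ∧ ∀ k i, n ≤ k → J.pd k i b = 0 := by
  obtain ⟨n, hn⟩ := J.exists_order a
  obtain ⟨m, hm⟩ := J.exists_order b
  exact ⟨max n m, fun k i h => hn k i (le_trans (le_max_left _ _) h),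
    fun k i h => hm k i (le_trans (le_max_right _ _) h)⟩

/-- The vector field `∑ c^i_k ∂/∂u^i_{(k)}` on the jet space. -/
def field (c : ℕ → Fin 2 → A) : Derivation ℝ A A :=
  Derivation.mk'
    { toFun := fun a => ∑ᶠ k, ∑ i, c k i * J.pd k i a
      map_add' := fun a b => by
        obtain ⟨n, ha, hb⟩ := J.exists_order₂ a b
        have hab : ∀ k i, n ≤ k → J.pd k i (a + b) = 0 := fun k i hk => by
          rw [map_add, ha k i hk, hb k i hk, add_zero]
        rw [finsum_eq_sum_range _ (J.sum_pd_eq_zero ha c),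
          finsum_eq_sum_range _ (J.sum_pd_eq_zero hb c),
          finsum_eq_sum_range _ (J.sum_pd_eq_zero hab c)]
        simp only [map_add, mul_add, Finset.sum_add_distrib]
      map_smul' := fun r a => by
        obtain ⟨n, ha⟩ := J.exists_order a
        have hra : ∀ k i, n ≤ k → J.pd k i (r • a) = 0 := fun k i hk => by
          rw [Derivation.map_smul, ha k i hk, smul_zero]
        rw [finsum_eq_sum_range _ (J.sum_pd_eq_zero ha c),
          finsum_eq_sum_range _ (J.sum_pd_eq_zero hra c)]
        simp only [Derivation.map_smul, mul_smul_comm, Finset.smul_sum, RingHom.id_apply] }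
    fun a b => by
      obtain ⟨n, ha, hb⟩ := J.exists_order₂ a b
      have hab : ∀ k i, n ≤ k → J.pd k i (a * b) = 0 := fun k i hk => by
        rw [Derivation.leibniz, ha k i hk, hb k i hk, smul_zero, smul_zero, add_zero]
      simp only [LinearMap.coe_mk, AddHom.coe_mk]
      rw [finsum_eq_sum_range _ (J.sum_pd_eq_zero ha c),
        finsum_eq_sum_range _ (J.sum_pd_eq_zero hb c),
        finsum_eq_sum_range _ (J.sum_pd_eq_zero hab c)]
      simp only [Derivation.leibniz, smul_eq_mul, Finset.mul_sum, ← Finset.sum_add_distrib]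
      refine Finset.sum_congr rfl fun k _ => Finset.sum_congr rfl fun i _ => ?_
      ring

theorem field_apply (c : ℕ → Fin 2 → A) (a : A) :
    J.field c a = ∑ᶠ k, ∑ i, c k i * J.pd k i a := rfl

theorem field_eq_sum (c : ℕ → Fin 2 → A) {a : A} {n : ℕ}
    (hn : ∀ k i, n ≤ k → J.pd k i a = 0) :
    J.field c a = ∑ k ∈ Finset.range n, ∑ i, c k i * J.pd k i a :=
  finsum_eq_sum_range _ (J.sum_pd_eq_zero hn c)

/-- The total derivative `∂/∂x + ∑ u^i_{(k+1)} ∂/∂u^i_{(k)}`. -/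
def D : Derivation ℝ A A := J.pdx + J.field fun k i => J.coord (k + 1) i

/-- The variational derivative `∑_k (-D)^k ∂/∂u^i_{(k)}`. -/
def euler (a : A) (i : Fin 2) : A := ∑ᶠ k : ℕ, (-1) ^ k * J.D^[k] (J.pd k i a)

/-- The evolutionary vector field with characteristic `v`. -/
def evol (v : Fin 2 → A) : Derivation ℝ A A := J.field fun k i => J.D^[k] (v i)

/-- A derivation acts on the coefficients and on the differentiated function separately. -/
theorem derivation_field (δ : Derivation ℝ A A) (c : ℕ → Fin 2 → A) {a : A} {n : ℕ}
    (hn : ∀ k i, n ≤ k → J.pd k i a = 0) :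
    δ (J.field c a) = J.field (fun k i => δ (c k i)) a +
      ∑ k ∈ Finset.range n, ∑ i, c k i * δ (J.pd k i a) := by
  rw [J.field_eq_sum c hn, J.field_eq_sum _ hn, map_sum, ← Finset.sum_add_distrib]
  refine Finset.sum_congr rfl fun k _ => ?_
  rw [map_sum, ← Finset.sum_add_distrib]
  refine Finset.sum_congr rfl fun i _ => ?_
  rw [Derivation.leibniz, smul_eq_mul, smul_eq_mul]
  ring

theorem pd_order {a : A} {n : ℕ} (hn : ∀ k i, n ≤ k → J.pd k i a = 0) (l : ℕ) (j : Fin 2) :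
    ∀ k i, n ≤ k → J.pd k i (J.pd l j a) = 0 := fun k i hk => by
  rw [J.pd_comm, hn k i hk, map_zero]

theorem pd_D (l : ℕ) (j : Fin 2) (a : A) :
    J.pd l j (J.D a) = J.D (J.pd l j a) +
      J.field (fun k i => if l = k + 1 ∧ j = i then 1 else 0) a := by
  obtain ⟨n, hn⟩ := J.exists_order a
  simp only [D, Derivation.add_apply, map_add, J.pd_pdx]
  rw [J.derivation_field _ _ hn, J.field_eq_sum _ (J.pd_order hn l j)]
  simp only [J.pd_coord, J.pd_comm l j]
  abel

theorem pd_zero_D (j : Fin 2) (a : A) : J.pd 0 j (J.D a) = J.D (J.pd 0 j a) := by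
  rw [pd_D, field_apply]
  simp

theorem pd_succ_D (l : ℕ) (j : Fin 2) (a : A) :
    J.pd (l + 1) j (J.D a) = J.D (J.pd (l + 1) j a) + J.pd l j a := by
  rw [pd_D, field_apply, finsum_eq_single _ l]
  · simp
  · intro k hk
    refine Finset.sum_eq_zero fun i _ => ?_
    rw [if_neg (by omega), zero_mul]

theorem D_coord (k : ℕ) (i : Fin 2) : J.D (J.coord k i) = J.coord (k + 1) i := by
  rw [D, Derivation.add_apply, J.pdx_coord, zero_add, field_apply, finsum_eq_single _ k]
  · simp [J.pd_coord]
  · intro l hl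
    simp [J.pd_coord, hl]

theorem D_x : J.D J.x = 1 := by
  rw [D, Derivation.add_apply, J.pdx_x, field_apply]
  simp [J.pd_x]

theorem evol_coord_zero (v : Fin 2 → A) (i : Fin 2) : J.evol v (J.coord 0 i) = v i := by
  rw [evol, field_apply, finsum_eq_single _ 0]
  · simp [J.pd_coord]
  · intro l hl
    simp [J.pd_coord, hl]

/-- Evolutionary vector fields commute with the total derivative. -/
theorem evol_D (v : Fin 2 → A) (a : A) : J.evol v (J.D a) = J.D (J.evol v a) := by
  obtain ⟨n, hn⟩ := J.exists_order a
  have hn1 : ∀ k i, n + 1 ≤ k → J.pd k i a = 0 := fun k i hk => hn k i (by omega)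
  have hD : ∀ k i, n + 1 ≤ k → J.pd k i (J.D a) = 0 := by
    intro k i hk
    obtain ⟨k, rfl⟩ : ∃ m, k = m + 1 := ⟨k - 1, by omega⟩
    rw [pd_succ_D, hn k i (by omega), hn (k + 1) i (by omega), map_zero, add_zero]
  rw [evol, J.derivation_field _ _ hn1, J.field_eq_sum _ hD, J.field_eq_sum _ hn,
    Finset.sum_range_succ', Finset.sum_range_succ' _ n]
  simp only [pd_zero_D, pd_succ_D, mul_add, Finset.sum_add_distrib, Function.iterate_succ_apply']
  abel

/-- `∫ a dx = 0`: `a` is a total derivative. -/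
def IsNull (a : A) : Prop := ∃ h, a = J.D h

variable {J}

theorem IsNull.add {a b : A} (ha : J.IsNull a) (hb : J.IsNull b) : J.IsNull (a + b) := by
  obtain ⟨h, rfl⟩ := ha
  obtain ⟨k, rfl⟩ := hb
  exact ⟨h + k, (map_add _ _ _).symm⟩

theorem IsNull.neg {a : A} (ha : J.IsNull a) : J.IsNull (-a) := by
  obtain ⟨h, rfl⟩ := ha
  exact ⟨-h, (map_neg _ _).symm⟩

theorem IsNull.sub {a b : A} (ha : J.IsNull a) (hb : J.IsNull b) : J.IsNull (a - b) := by
  rw [sub_eq_add_neg]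
  exact ha.add hb.neg

theorem IsNull.sum {ι : Type*} (s : Finset ι) {F : ι → A} (h : ∀ i ∈ s, J.IsNull (F i)) :
    J.IsNull (∑ i ∈ s, F i) :=
  Finset.sum_induction F J.IsNull (fun _ _ => IsNull.add) ⟨0, (map_zero _).symm⟩ h

theorem IsNull.evol {a : A} (ha : J.IsNull a) (v : Fin 2 → A) : J.IsNull (J.evol v a) := by
  obtain ⟨h, rfl⟩ := ha
  exact ⟨J.evol v h, J.evol_D v h⟩

variable (J)

/-- Repeated integration by parts. -/
theorem isNull_iterate_mul_sub (k : ℕ) (v w : A) :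
    J.IsNull (J.D^[k] v * w - v * ((-1) ^ k * J.D^[k] w)) := by
  induction k generalizing w with
  | zero => exact ⟨0, by simp⟩
  | succ k ih =>
    obtain ⟨h, hh⟩ := ih (J.D w)
    refine ⟨J.D^[k] v * w - h, ?_⟩
    rw [map_sub, ← hh, Derivation.leibniz, Function.iterate_succ_apply',
      Function.iterate_succ_apply, smul_eq_mul, smul_eq_mul]
    ring

theorem euler_eq_sum {a : A} {n : ℕ} (hn : ∀ k i, n ≤ k → J.pd k i a = 0) (i : Fin 2) :
    J.euler a i = ∑ k ∈ Finset.range n, (-1) ^ k * J.D^[k] (J.pd k i a) :=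
  finsum_eq_sum_range _ fun k hk => by rw [hn k i hk, iterate_map_zero, mul_zero]

/-- The variational derivative is the gradient: `X_v a` and `∑ v^i δa/δu^i` define the same
functional. -/
theorem isNull_evol_sub (v : Fin 2 → A) (a : A) :
    J.IsNull (J.evol v a - ∑ i, v i * J.euler a i) := by
  obtain ⟨n, hn⟩ := J.exists_order a
  have : J.evol v a - ∑ i, v i * J.euler a i = ∑ k ∈ Finset.range n, ∑ i,
      (J.D^[k] (v i) * J.pd k i a - v i * ((-1) ^ k * J.D^[k] (J.pd k i a))) := by
    rw [evol, J.field_eq_sum _ hn]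
    simp only [J.euler_eq_sum hn, Finset.mul_sum, Finset.sum_sub_distrib]
    rw [Finset.sum_comm (s := Finset.univ) (t := Finset.range n)]
  rw [this]
  exact IsNull.sum _ fun k _ => IsNull.sum _ fun i _ => J.isNull_iterate_mul_sub k _ _

/-- Total derivatives have vanishing variational derivative: with `[∂/∂u^i_{(k+1)}, D] =
∂/∂u^i_{(k)}` the alternating sum telescopes. -/
theorem euler_D (a : A) (i : Fin 2) : J.euler (J.D a) i = 0 := by
  obtain ⟨n, hn, hD⟩ := J.exists_order₂ a (J.D a)
  have key : ∀ m : ℕ, ∑ k ∈ Finset.range (m + 1), (-1) ^ k * J.D^[k] (J.pd k i (J.D a)) =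
      (-1) ^ m * J.D^[m + 1] (J.pd m i a) := by
    intro m
    induction m with
    | zero => simp [pd_zero_D]
    | succ m ih =>
      rw [Finset.sum_range_succ, ih, pd_succ_D, iterate_map_add,
        ← Function.iterate_succ_apply (f := J.D)]
      rw [Function.iterate_succ_apply (f := J.D) (n := m + 1)]
      ring
  rw [J.euler_eq_sum (n := n + 1) (fun k j hk => hD k j (by omega)), key, hn n i le_rfl,
    iterate_map_zero, mul_zero]

theorem IsNull.euler {a : A} (ha : J.IsNull a) (i : Fin 2) : J.euler a i = 0 := by
  obtain ⟨h, rfl⟩ := ha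
  exact J.euler_D h i

theorem evol_iterate_D (v : Fin 2 → A) (k : ℕ) (a : A) :
    J.evol v (J.D^[k] a) = J.D^[k] (J.evol v a) := by
  induction k generalizing a with
  | zero => rfl
  | succ k ih => rw [Function.iterate_succ_apply, ih, evol_D, Function.iterate_succ_apply]

/-- Evolutionary vector fields are closed under commutators. -/
theorem evol_evol_sub (v w : Fin 2 → A) (a : A) :
    J.evol v (J.evol w a) - J.evol w (J.evol v a) =
      J.evol (fun i => J.evol v (w i) - J.evol w (v i)) a := by
  obtain ⟨n, hn⟩ := J.exists_order a
  have key : ∀ v w : Fin 2 → A, J.evol v (J.evol w a) =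
      J.evol (fun i => J.evol v (w i)) a + ∑ k ∈ Finset.range n, ∑ i, ∑ l ∈ Finset.range n,
        ∑ j, J.D^[k] (w i) * (J.D^[l] (v j) * J.pd l j (J.pd k i a)) := by
    intro v w
    conv_lhs => rw [evol.eq_def J w]
    rw [J.derivation_field _ _ hn]
    simp only [evol_iterate_D]
    congr 1
    refine Finset.sum_congr rfl fun k _ => Finset.sum_congr rfl fun i _ => ?_
    rw [evol, J.field_eq_sum _ (J.pd_order hn k i), Finset.mul_sum]
    exact Finset.sum_congr rfl fun l _ => Finset.mul_sum _ _ _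
  have symm : (∑ k ∈ Finset.range n, ∑ i, ∑ l ∈ Finset.range n,
        ∑ j, J.D^[k] (w i) * (J.D^[l] (v j) * J.pd l j (J.pd k i a))) =
      ∑ k ∈ Finset.range n, ∑ i, ∑ l ∈ Finset.range n,
        ∑ j, J.D^[k] (v i) * (J.D^[l] (w j) * J.pd l j (J.pd k i a)) := by
    have h := Finset.sum_comm (s := Finset.range n ×ˢ (Finset.univ : Finset (Fin 2)))
      (t := Finset.range n ×ˢ (Finset.univ : Finset (Fin 2)))
      (f := fun p q => J.D^[p.1] (w p.2) * (J.D^[q.1] (v q.2) * J.pd q.1 q.2 (J.pd p.1 p.2 a)))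
    simp only [Finset.sum_product] at h
    rw [h]
    refine Finset.sum_congr rfl fun k _ => Finset.sum_congr rfl fun i _ =>
      Finset.sum_congr rfl fun l _ => Finset.sum_congr rfl fun j _ => ?_
    rw [J.pd_comm]
    ring
  rw [key v w, key w v, symm, add_sub_add_right_eq_sub]
  simp only [evol, J.field_eq_sum _ hn, ← Finset.sum_sub_distrib, iterate_map_sub, sub_mul]

/-- Helmholtz: the linearization of a variational derivative is formally self-adjoint. This is
`[X_v, X_w] = X_{[v, w]}` applied to `a`, read modulo total derivatives. -/
theorem isNull_helmholtz (v w : Fin 2 → A) (a : A) :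
    J.IsNull (∑ i, w i * J.evol v (J.euler a i) - ∑ i, v i * J.evol w (J.euler a i)) := by
  have h1 := (J.isNull_evol_sub w a).evol v
  have h2 := (J.isNull_evol_sub v a).evol w
  have h3 := J.isNull_evol_sub (fun i => J.evol v (w i) - J.evol w (v i)) a
  rw [← evol_evol_sub] at h3
  convert (h3.sub h1).add h2 using 1
  simp only [map_sub, map_add, Derivation.leibniz, smul_eq_mul, Fin.sum_univ_two]
  ring

/-- The density `∑ (δf/δu^i) P(δg/δu)^i` of the bracket of the functionals `∫ f dx` and `∫ g dx`. -/
def bracket (P : (Fin 2 → A) → Fin 2 → A) (f g : A) : A :=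
  ∑ i, J.euler f i * P (J.euler g) i

/-- The derivative of the operator `P` along the evolutionary field `v`, applied to `φ`. -/
def lie (P : (Fin 2 → A) → Fin 2 → A) (v φ : Fin 2 → A) (i : Fin 2) : A :=
  J.evol v (P φ i) - P (fun j => J.evol v (φ j)) i

/-- For a formally skew-adjoint `P` the second variations of `f, g, h` drop out of the Jacobi
identity: what remains is tensorial in the variational derivatives and involves only the
derivative `lie P` of the operator along its own evolutionary fields. -/
theorem isNull_jacobi_sub (P : (Fin 2 → A) → Fin 2 → A)
    (hP : ∀ ψ φ, J.IsNull (∑ i, ψ i * P φ i + ∑ i, φ i * P ψ i)) (f g h : A) :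
    J.IsNull
      ((J.bracket P (J.bracket P f g) h + J.bracket P (J.bracket P g h) f +
        J.bracket P (J.bracket P h f) g) -
      (∑ i, J.euler f i * J.lie P (P (J.euler h)) (J.euler g) i +
        ∑ i, J.euler g i * J.lie P (P (J.euler f)) (J.euler h) i +
        ∑ i, J.euler h i * J.lie P (P (J.euler g)) (J.euler f) i)) := by
  have key : ∀ f g h : A, J.IsNull (J.bracket P (J.bracket P f g) h -
      (∑ i, J.euler f i * J.lie P (P (J.euler h)) (J.euler g) i +
        ∑ i, P (J.euler g) i * J.evol (P (J.euler h)) (J.euler f i) -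
        ∑ i, P (J.euler h) i * J.evol (P (J.euler f)) (J.euler g i))) := by
    intro f g h
    have h1 := J.isNull_evol_sub (P (J.euler h)) (J.bracket P f g)
    have h2 := hP (J.euler f) (fun j => J.evol (P (J.euler h)) (J.euler g j))
    have h3 := J.isNull_helmholtz (P (J.euler f)) (P (J.euler h)) g
    convert (h2.sub h1).add h3 using 1
    simp only [lie]
    conv_lhs => rw [bracket]
    rw [bracket]
    simp only [map_add, Derivation.leibniz, smul_eq_mul, Fin.sum_univ_two]
    ring
  convert ((key f g h).add (key g h f)).add (key h f g) using 1
  ring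

/-! ### Functionals multiplied by functions of `x` -/

/-- `D^k (t^{n+k} y) ≡ ((n+k)!/n!) t^n y` modulo `t^{n+1}` if `D t = 1`. -/
theorem exists_iterate_D_pow_mul {t : A} (ht : J.D t = 1) (k n : ℕ) (y : A) :
    ∃ z, J.D^[k] (t ^ (n + k) * y) = t ^ n * ((n + 1).ascFactorial k • y + t * z) := by
  induction k generalizing y with
  | zero => exact ⟨0, by simp⟩
  | succ k ih =>
    obtain ⟨z, hz⟩ := ih ((n + k + 1) • y + t * J.D y)
    refine ⟨(n + 1).ascFactorial k • J.D y + z, ?_⟩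
    have : J.D (t ^ (n + (k + 1)) * y) = t ^ (n + k) * ((n + k + 1) • y + t * J.D y) := by
      rw [Derivation.leibniz, Derivation.leibniz_pow, ht, ← add_assoc, Nat.add_sub_cancel]
      simp only [smul_eq_mul, nsmul_eq_mul]
      push_cast
      ring
    rw [Function.iterate_succ_apply, this, hz, Nat.ascFactorial_succ]
    simp only [nsmul_eq_mul]
    push_cast
    ring

theorem euler_pow_mul {t : A} (hpt : ∀ k i, J.pd k i t = 0) (m : ℕ) {Z : A} {n : ℕ}
    (hn : ∀ k i, n ≤ k → J.pd k i Z = 0) (i : Fin 2) :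
    J.euler (t ^ m * Z) i = ∑ k ∈ Finset.range n, (-1) ^ k * J.D^[k] (t ^ m * J.pd k i Z) := by
  have h : ∀ k i, J.pd k i (t ^ m * Z) = t ^ m * J.pd k i Z := fun k i => by
    rw [Derivation.leibniz, Derivation.leibniz_pow, hpt]
    simp
  rw [J.euler_eq_sum (n := n) (fun k j hk => by rw [h, hn k j hk, mul_zero])]
  simp only [h]

/-- If `γ(x) Z` is a total derivative for every polynomial `γ`, then `Z` depends on `x` only. -/
theorem pd_eq_zero_of_forall_isNull (Z : A)
    (h : ∀ (r : ℝ) (m : ℕ), J.IsNull ((J.x - algebraMap ℝ A r) ^ m * Z)) (k : ℕ) (i : Fin 2) :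
    J.pd k i Z = 0 := by
  obtain ⟨n, hn⟩ := J.exists_order Z
  revert k i
  induction n with
  | zero => exact fun k i => hn k i (Nat.zero_le k)
  | succ n ih =>
    refine ih (fun k i hk => ?_)
    rcases hk.eq_or_lt with rfl | hk
    -- For `t = x - r`, the variational derivative of `t^n Z` is `± n! ∂Z/∂u_{(n)}` where `t = 0`.
    · refine J.eq_zero_of_dvd _ fun r => ?_
      set t := J.x - algebraMap ℝ A r with ht
      have ht1 : J.D t = 1 := by rw [ht, map_sub, D_x, Derivation.map_algebraMap, sub_zero]
      have hpt : ∀ k i, J.pd k i t = 0 := fun k i => by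
        rw [ht, map_sub, J.pd_x, Derivation.map_algebraMap, sub_zero]
      have h0 := IsNull.euler J (h r n) i
      rw [J.euler_pow_mul hpt n hn, Finset.sum_range_succ] at h0
      have hlow : t ∣ ∑ k ∈ Finset.range n, (-1) ^ k * J.D^[k] (t ^ n * J.pd k i Z) := by
        refine Finset.dvd_sum fun k hk => Dvd.dvd.mul_left ?_ _
        have hk : k < n := by simpa using hk
        obtain ⟨z, hz⟩ := J.exists_iterate_D_pow_mul ht1 k (n - k) (J.pd k i Z)
        rw [Nat.sub_add_cancel hk.le] at hz
        rw [hz]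
        exact Dvd.dvd.mul_right (dvd_pow_self t (by omega)) _
      obtain ⟨w, hw⟩ := hlow
      obtain ⟨z, hz⟩ := J.exists_iterate_D_pow_mul ht1 n 0 (J.pd n i Z)
      rw [zero_add, pow_zero, one_mul, zero_add, Nat.one_ascFactorial] at hz
      rw [hw, hz] at h0
      have hsq : ((-1 : A) ^ n) * (-1) ^ n = 1 := by rw [← mul_pow]; simp
      have h1 : (n.factorial : ℝ) • J.pd n i Z = t * (-((-1) ^ n * w) - z) := by
        rw [Algebra.smul_def, map_natCast]
        rw [nsmul_eq_mul] at h0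
        linear_combination (-1) ^ n * h0 - ((n.factorial : A) * J.pd n i Z + t * z) * hsq
      have hne : (n.factorial : ℝ) ≠ 0 := by positivity
      refine ⟨(n.factorial : ℝ)⁻¹ • (-((-1) ^ n * w) - z), ?_⟩
      rw [mul_smul_comm, ← h1, smul_smul, inv_mul_cancel₀ hne, one_smul]
    · exact hn k i hk

/-! ### Hamiltonian operators -/

/-- The first-order operator `g^{ij} D + Γ^{ij}_k u^k_x`. -/
def hydro (g : Fin 2 → Fin 2 → A) (Γ : Fin 2 → Fin 2 → Fin 2 → A) (φ : Fin 2 → A) (i : Fin 2) :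
    A :=
  ∑ j, (g i j * J.D (φ j) + (∑ k, Γ i j k * J.coord 1 k) * φ j)

/-- The operator `[[0, 1], [-1, 0]] D²`. -/
def second (φ : Fin 2 → A) : Fin 2 → A := ![J.D (J.D (φ 1)), -J.D (J.D (φ 0))]

/-- The operator `s (g^{ij} D + Γ^{ij}_k u^k_x) + t [[0, 1], [-1, 0]] D²`. -/
def pencil (s t : ℝ) (g : Fin 2 → Fin 2 → A) (Γ : Fin 2 → Fin 2 → Fin 2 → A)
    (φ : Fin 2 → A) (i : Fin 2) : A :=
  s • J.hydro g Γ φ i + t • J.second φ i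

/-- The bracket of `P` is skew-symmetric and satisfies the Jacobi identity modulo total
derivatives. -/
def IsPoisson (P : (Fin 2 → A) → Fin 2 → A) : Prop :=
  (∀ f g, J.IsNull (J.bracket P f g + J.bracket P g f)) ∧
  ∀ f g h, J.IsNull (J.bracket P (J.bracket P f g) h + J.bracket P (J.bracket P g h) f +
    J.bracket P (J.bracket P h f) g)

/-! ### The family is Hamiltonian -/

/-- The operator is `s (c ⊗ u D + D u ⊗ c + η D) + t [[0, 1], [-1, 0]] D²`: up to constant
coefficients, the Lie-Poisson operator of the Lie algebra `[ψ, φ] = (c·ψ) φ' - (c·φ) ψ'`, for which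
`η D` and the second-order operator are cocycles. -/
theorem isPoisson_pencil (s t : ℝ) (c : Fin 2 → ℝ) (η : Fin 2 → Fin 2 → ℝ)
    (hη : η 0 1 = η 1 0) :
    J.IsPoisson (J.pencil s t
      (fun i j => c i • J.coord 0 j + c j • J.coord 0 i + algebraMap ℝ A (η i j))
      (fun i j k => if i = k then algebraMap ℝ A (c j) else 0)) := by
  set P := J.pencil s t
      (fun i j => c i • J.coord 0 j + c j • J.coord 0 i + algebraMap ℝ A (η i j))
      (fun i j k => if i = k then algebraMap ℝ A (c j) else 0) with hP
  have hP0 : ∀ φ, P φ 0 = algebraMap ℝ A s *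
      ((algebraMap ℝ A (c 0) * J.coord 0 0 + algebraMap ℝ A (c 0) * J.coord 0 0 +
        algebraMap ℝ A (η 0 0)) * J.D (φ 0) +
      (algebraMap ℝ A (c 0) * J.coord 0 1 + algebraMap ℝ A (c 1) * J.coord 0 0 +
        algebraMap ℝ A (η 0 1)) * J.D (φ 1) +
      (algebraMap ℝ A (c 0) * φ 0 + algebraMap ℝ A (c 1) * φ 1) * J.coord 1 0) +
      algebraMap ℝ A t * J.D (J.D (φ 1)) := by
    intro φ
    simp [hP, pencil, hydro, second, Algebra.smul_def, Fin.sum_univ_two]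
    ring
  have hP1 : ∀ φ, P φ 1 = algebraMap ℝ A s *
      ((algebraMap ℝ A (c 0) * J.coord 0 1 + algebraMap ℝ A (c 1) * J.coord 0 0 +
        algebraMap ℝ A (η 0 1)) * J.D (φ 0) +
      (algebraMap ℝ A (c 1) * J.coord 0 1 + algebraMap ℝ A (c 1) * J.coord 0 1 +
        algebraMap ℝ A (η 1 1)) * J.D (φ 1) +
      (algebraMap ℝ A (c 0) * φ 0 + algebraMap ℝ A (c 1) * φ 1) * J.coord 1 1) -
      algebraMap ℝ A t * J.D (J.D (φ 0)) := by
    intro φ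
    simp [hP, pencil, hydro, second, Algebra.smul_def, Fin.sum_univ_two, hη]
    ring
  clear_value P
  have hskew : ∀ ψ φ, J.IsNull (∑ i, ψ i * P φ i + ∑ i, φ i * P ψ i) := by
    intro ψ φ
    refine ⟨algebraMap ℝ A s * ((algebraMap ℝ A (c 0) * ψ 0 + algebraMap ℝ A (c 1) * ψ 1) *
        (J.coord 0 0 * φ 0 + J.coord 0 1 * φ 1) +
        (algebraMap ℝ A (c 0) * φ 0 + algebraMap ℝ A (c 1) * φ 1) *
        (J.coord 0 0 * ψ 0 + J.coord 0 1 * ψ 1) +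
        algebraMap ℝ A (η 0 0) * ψ 0 * φ 0 + algebraMap ℝ A (η 1 1) * ψ 1 * φ 1 +
        algebraMap ℝ A (η 0 1) * (ψ 0 * φ 1 + ψ 1 * φ 0)) +
      algebraMap ℝ A t * (ψ 0 * J.D (φ 1) - ψ 1 * J.D (φ 0) + φ 0 * J.D (ψ 1)
        - φ 1 * J.D (ψ 0)), ?_⟩
    simp only [Fin.sum_univ_two, hP0, hP1, map_add, map_sub, Derivation.leibniz,
      Derivation.map_algebraMap, smul_eq_mul, D_coord]
    ring
  have hlie : ∀ ψ v φ : Fin 2 → A, ∑ i, ψ i * J.lie P v φ i = algebraMap ℝ A s *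
      ((algebraMap ℝ A (c 0) * ψ 0 + algebraMap ℝ A (c 1) * ψ 1) *
        (v 0 * J.D (φ 0) + v 1 * J.D (φ 1)) -
       (algebraMap ℝ A (c 0) * φ 0 + algebraMap ℝ A (c 1) * φ 1) *
        (v 0 * J.D (ψ 0) + v 1 * J.D (ψ 1))) + J.D (algebraMap ℝ A s *
        ((v 0 * ψ 0 + v 1 * ψ 1) *
          (algebraMap ℝ A (c 0) * φ 0 + algebraMap ℝ A (c 1) * φ 1))) := by
    intro ψ v φ
    have h1 : ∀ i, J.coord 1 i = J.D (J.coord 0 i) := fun i => (J.D_coord 0 i).symm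
    simp only [Fin.sum_univ_two, lie, hP0, hP1, map_add, map_sub, Derivation.leibniz,
      Derivation.map_algebraMap, smul_eq_mul, h1, evol_D, evol_coord_zero]
    ring
  refine ⟨fun f g => hskew _ _, fun f g h => ?_⟩
  have hj := J.isNull_jacobi_sub P hskew f g h
  suffices hc : ∀ ψ φ χ : Fin 2 → A, J.IsNull (∑ i, ψ i * J.lie P (P χ) φ i +
      ∑ i, φ i * J.lie P (P ψ) χ i + ∑ i, χ i * J.lie P (P φ) ψ i) by
    convert hj.add (hc (J.euler f) (J.euler g) (J.euler h)) using 1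
    ring
  intro ψ φ χ
  simp only [hlie]
  set S := algebraMap ℝ A s
  set T := algebraMap ℝ A t
  set α := algebraMap ℝ A (c 0) * ψ 0 + algebraMap ℝ A (c 1) * ψ 1 with hα
  set β := algebraMap ℝ A (c 0) * φ 0 + algebraMap ℝ A (c 1) * φ 1 with hβ
  set δ := algebraMap ℝ A (c 0) * χ 0 + algebraMap ℝ A (c 1) * χ 1 with hδ
  -- The Jacobi identity of the Lie algebra, and the closedness of its two cocycles. The term with
  -- `S * T` uses that three vectors `ψ', φ', χ'` in the plane are linearly dependent.
  have key : J.IsNull (S *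
      (α * (P χ 0 * J.D (φ 0) + P χ 1 * J.D (φ 1)) -
       β * (P χ 0 * J.D (ψ 0) + P χ 1 * J.D (ψ 1))) + S *
      (β * (P ψ 0 * J.D (χ 0) + P ψ 1 * J.D (χ 1)) -
       δ * (P ψ 0 * J.D (φ 0) + P ψ 1 * J.D (φ 1))) + S *
      (δ * (P φ 0 * J.D (ψ 0) + P φ 1 * J.D (ψ 1)) -
       α * (P φ 0 * J.D (χ 0) + P φ 1 * J.D (χ 1)))) := by
    refine ⟨S * S * (
      δ * (J.coord 0 0 * (α * J.D (φ 0) - β * J.D (ψ 0)) +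
        J.coord 0 1 * (α * J.D (φ 1) - β * J.D (ψ 1))) +
      α * (J.coord 0 0 * (β * J.D (χ 0) - δ * J.D (φ 0)) +
        J.coord 0 1 * (β * J.D (χ 1) - δ * J.D (φ 1))) +
      β * (J.coord 0 0 * (δ * J.D (ψ 0) - α * J.D (χ 0)) +
        J.coord 0 1 * (δ * J.D (ψ 1) - α * J.D (χ 1)))) +
      S * T * (α * (J.D (φ 0) * J.D (χ 1) - J.D (φ 1) * J.D (χ 0)) +
        β * (J.D (χ 0) * J.D (ψ 1) - J.D (χ 1) * J.D (ψ 0)) +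
        δ * (J.D (ψ 0) * J.D (φ 1) - J.D (ψ 1) * J.D (φ 0))), ?_⟩
    simp only [S, T, hα, hβ, hδ, hP0, hP1, map_add, map_sub, Derivation.leibniz,
      Derivation.map_algebraMap, smul_eq_mul, D_coord]
    ring
  obtain ⟨k, hk⟩ := key
  refine ⟨k + S * ((P χ 0 * ψ 0 + P χ 1 * ψ 1) * β) + S * ((P ψ 0 * φ 0 + P ψ 1 * φ 1) * δ) +
    S * ((P φ 0 * χ 0 + P φ 1 * χ 1) * α), ?_⟩
  rw [map_add, map_add, map_add, ← hk]
  ring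

/-! ### Test functionals -/

/-- Functionals `∫ χ W dx`, for all `χ = γ(x)` and `χ = γ(x) u^l`, detect `W`. Functions `γ(x)`
alone do not suffice, since a function of `x` is always a total derivative. -/
theorem eq_zero_of_forall_isNull (l : Fin 2) (W : A)
    (h1 : ∀ (r : ℝ) (m : ℕ), J.IsNull ((J.x - algebraMap ℝ A r) ^ m * W))
    (h2 : ∀ (r : ℝ) (m : ℕ), J.IsNull ((J.x - algebraMap ℝ A r) ^ m * J.coord 0 l * W)) :
    W = 0 := by
  have hW := J.pd_eq_zero_of_forall_isNull W h1 0 l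
  have hu := J.pd_eq_zero_of_forall_isNull (J.coord 0 l * W)
    (fun r m => by rw [← mul_assoc]; exact h2 r m) 0 l
  rw [Derivation.leibniz, hW, smul_zero, zero_add, J.pd_coord, if_pos ⟨rfl, rfl⟩,
    smul_eq_mul, mul_one] at hu
  exact hu

theorem euler_of_order_zero {a : A} (ha : ∀ k i, J.pd (k + 1) i a = 0) :
    J.euler a = fun i => J.pd 0 i a := by
  funext i
  rw [J.euler_eq_sum (n := 1) (fun k j hk => ?_)]
  · simp
  · obtain ⟨k, rfl⟩ : ∃ m, k = m + 1 := ⟨k - 1, by omega⟩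
    exact ha k j

theorem pd_pow_x_sub (r : ℝ) (m k : ℕ) (i : Fin 2) :
    J.pd k i ((J.x - algebraMap ℝ A r) ^ m) = 0 := by
  rw [Derivation.leibniz_pow, map_sub, J.pd_x, Derivation.map_algebraMap]
  simp

theorem euler_linear (r : ℝ) (m : ℕ) (l : Fin 2) :
    J.euler ((J.x - algebraMap ℝ A r) ^ m * J.coord 0 l) =
      Pi.single l ((J.x - algebraMap ℝ A r) ^ m) := by
  rw [euler_of_order_zero]
  · funext i
    rw [Derivation.leibniz, pd_pow_x_sub, J.pd_coord, Pi.single_apply]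
    simp
  · intro k i
    rw [Derivation.leibniz, pd_pow_x_sub, J.pd_coord]
    simp

theorem euler_quadratic (r : ℝ) (m : ℕ) (l : Fin 2) :
    J.euler ((J.x - algebraMap ℝ A r) ^ m * ((1 / 2 : ℝ) • J.coord 0 l ^ 2)) =
      Pi.single l ((J.x - algebraMap ℝ A r) ^ m * J.coord 0 l) := by
  rw [euler_of_order_zero]
  · funext i
    rw [Derivation.leibniz, pd_pow_x_sub, Derivation.map_smul, Derivation.leibniz_pow, J.pd_coord,
      Pi.single_apply]
    by_cases h : i = l
    · simp [h, Algebra.smul_def]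
      congr 1
      rw [← mul_assoc, ← map_ofNat (algebraMap ℝ A) 2, ← map_mul]
      norm_num
    · simp [h]
  · intro k i
    rw [Derivation.leibniz, pd_pow_x_sub, Derivation.map_smul, Derivation.leibniz_pow, J.pd_coord]
    simp

/-- If a functional on covectors is `c ↦ ∫ c W dx` on the covectors `c e_l`, and vanishes on all
variational derivatives, then `W = 0`. -/
theorem eq_zero_of_forall_euler (l : Fin 2) (W : A) (F : (Fin 2 → A) → A)
    (hF : ∀ c, J.IsNull (F (Pi.single l c) - c * W)) (h : ∀ f, J.IsNull (F (J.euler f))) :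
    W = 0 := by
  refine J.eq_zero_of_forall_isNull l W (fun r m => ?_) fun r m => ?_
  · have h1 := (h ((J.x - algebraMap ℝ A r) ^ m * J.coord 0 l)).sub
      (hF ((J.x - algebraMap ℝ A r) ^ m))
    rwa [euler_linear, sub_sub_cancel] at h1
  · have h1 := (h ((J.x - algebraMap ℝ A r) ^ m * ((1 / 2 : ℝ) • J.coord 0 l ^ 2))).sub
      (hF ((J.x - algebraMap ℝ A r) ^ m * J.coord 0 l))
    rwa [euler_quadratic, sub_sub_cancel] at h1

/-! ### Necessary conditions -/

/-- Skew-symmetry of the bracket: `g` is symmetric and `Γ` is compatible with it. -/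
theorem hydro_skew {g : Fin 2 → Fin 2 → A} {Γ : Fin 2 → Fin 2 → Fin 2 → A}
    (hP : J.IsPoisson (J.hydro g Γ)) (i j : Fin 2) :
    g i j = g j i ∧ J.D (g i j) = ∑ k, (Γ i j k + Γ j i k) * J.coord 1 k := by
  have key : ∀ (r : ℝ) (m : ℕ),
      (g j i - g i j) * J.D ((J.x - algebraMap ℝ A r) ^ m) + (J.x - algebraMap ℝ A r) ^ m *
        (∑ k, (Γ i j k + Γ j i k) * J.coord 1 k - J.D (g i j)) = 0 := by
    intro r m
    set a := (J.x - algebraMap ℝ A r) ^ m with ha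
    refine J.eq_zero_of_forall_euler j _ (fun χ => ∑ p, (Pi.single i a : Fin 2 → A) p *
      J.hydro g Γ χ p + ∑ p, χ p * J.hydro g Γ (Pi.single i a) p) (fun c => ?_) (fun f => ?_)
    · refine ⟨a * g i j * c, ?_⟩
      have h1 : ∀ (i j : Fin 2) (a c : A), ∑ p, (Pi.single i a : Fin 2 → A) p *
          J.hydro g Γ (Pi.single j c) p =
          a * (g i j * J.D c + (∑ k, Γ i j k * J.coord 1 k) * c) := by
        intro i j a c
        fin_cases i <;> fin_cases j <;> simp [hydro]
      simp only [h1, Derivation.leibniz, smul_eq_mul, Fin.sum_univ_two]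
      ring
    · have h1 := hP.1 (a * J.coord 0 i) f
      rwa [bracket, bracket, euler_linear] at h1
  have h0 := key 0 0
  rw [pow_zero, Derivation.map_one_eq_zero, mul_zero, zero_add, one_mul, sub_eq_zero] at h0
  have h1 := key 0 1
  rw [h0, sub_self, mul_zero, add_zero, pow_one, map_sub, D_x, Derivation.map_algebraMap,
    sub_zero, mul_one, sub_eq_zero] at h1
  exact ⟨h1.symm, h0.symm⟩

theorem isNull_hydro_add {g : Fin 2 → Fin 2 → A} {Γ : Fin 2 → Fin 2 → Fin 2 → A}
    (hP : J.IsPoisson (J.hydro g Γ)) (ψ φ : Fin 2 → A) :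
    J.IsNull (∑ i, ψ i * J.hydro g Γ φ i + ∑ i, φ i * J.hydro g Γ ψ i) := by
  refine ⟨∑ i, ∑ j, g i j * ψ i * φ j, ?_⟩
  have h10 := (J.hydro_skew hP 1 0).1
  have d00 := (J.hydro_skew hP 0 0).2
  have d01 := (J.hydro_skew hP 0 1).2
  have d11 := (J.hydro_skew hP 1 1).2
  simp only [Fin.sum_univ_two] at d00 d01 d11
  simp only [hydro, Fin.sum_univ_two, map_add, Derivation.leibniz, smul_eq_mul, h10,
    d00, d01, d11]
  ring

theorem isNull_second_add (ψ φ : Fin 2 → A) :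
    J.IsNull (∑ i, ψ i * J.second φ i + ∑ i, φ i * J.second ψ i) := by
  refine ⟨ψ 0 * J.D (φ 1) - ψ 1 * J.D (φ 0) + φ 0 * J.D (ψ 1) - φ 1 * J.D (ψ 0), ?_⟩
  simp [second, Fin.sum_univ_two]
  ring

theorem lie_second (v φ : Fin 2 → A) (i : Fin 2) : J.lie J.second v φ i = 0 := by
  fin_cases i <;> simp [lie, second, evol_D]

theorem lie_hydro (g : Fin 2 → Fin 2 → A) (Γ : Fin 2 → Fin 2 → Fin 2 → A) (v φ : Fin 2 → A)
    (i : Fin 2) :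
    J.lie (J.hydro g Γ) v φ i = ∑ j, (J.evol v (g i j) * J.D (φ j) +
      (∑ k, (J.evol v (Γ i j k) * J.coord 1 k + Γ i j k * J.D (v k))) * φ j) := by
  have h1 : ∀ i, J.evol v (J.coord 1 i) = J.D (v i) := fun i => by
    rw [← D_coord, evol_D, evol_coord_zero]
  simp only [lie, hydro, Fin.sum_univ_two, map_add, Derivation.leibniz, smul_eq_mul, evol_D, h1]
  ring

/-- The part of the Jacobi identity of the pencil which is linear in both operators. -/
theorem isNull_mixed_jacobi {g : Fin 2 → Fin 2 → A} {Γ : Fin 2 → Fin 2 → Fin 2 → A}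
    (hP : J.IsPoisson (J.hydro g Γ)) (hQ : J.IsPoisson (J.pencil 1 1 g Γ)) (f g' h : A) :
    J.IsNull (∑ i, J.euler f i * J.lie (J.hydro g Γ) (J.second (J.euler h)) (J.euler g') i +
        ∑ i, J.euler g' i * J.lie (J.hydro g Γ) (J.second (J.euler f)) (J.euler h) i +
        ∑ i, J.euler h i * J.lie (J.hydro g Γ) (J.second (J.euler g')) (J.euler f) i) := by
  have hQs : ∀ ψ φ, J.IsNull (∑ i, ψ i * J.pencil 1 1 g Γ φ i +
      ∑ i, φ i * J.pencil 1 1 g Γ ψ i) := fun ψ φ => by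
    convert (J.isNull_hydro_add hP ψ φ).add (J.isNull_second_add ψ φ) using 1
    simp only [pencil, one_smul, Fin.sum_univ_two]
    ring
  have h1 := (hP.2 f g' h).sub (J.isNull_jacobi_sub _ (J.isNull_hydro_add hP) f g' h)
  have h2 := (hQ.2 f g' h).sub (J.isNull_jacobi_sub _ hQs f g' h)
  rw [sub_sub_cancel] at h1 h2
  have hl : ∀ χ φ i, J.lie (J.pencil 1 1 g Γ) (J.pencil 1 1 g Γ χ) φ i =
      J.lie (J.hydro g Γ) (J.hydro g Γ χ) φ i + J.lie (J.hydro g Γ) (J.second χ) φ i := by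
    intro χ φ i
    have hadd : ∀ (v w : Fin 2 → A) (a : A), J.evol (fun i => v i + w i) a =
        J.evol v a + J.evol w a := by
      intro v w a
      obtain ⟨n, hn⟩ := J.exists_order a
      simp only [evol, J.field_eq_sum _ hn, iterate_map_add, add_mul, Finset.sum_add_distrib]
    have hp : ∀ v, J.lie (J.pencil 1 1 g Γ) v φ i = J.lie (J.hydro g Γ) v φ i := fun v => by
      have := J.lie_second v φ i
      simp only [lie, pencil, one_smul, map_add] at this ⊢
      linear_combination this
    rw [hp]
    have : J.pencil 1 1 g Γ χ = fun i => J.hydro g Γ χ i + J.second χ i := by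
      funext i
      simp [pencil]
    simp only [lie_hydro, this, hadd, map_add, Fin.sum_univ_two]
    ring
  convert h2.sub h1 using 1
  simp only [hl, Fin.sum_univ_two]
  ring

/-- `∑_k ω^{kl} w_k`, where `ω = [[0, 1], [-1, 0]]`. -/
def rot (w : Fin 2 → A) (l : Fin 2) : A := ![-w 1, w 0] l

/-- The derivative `∑_k ω^{kl} ∂G/∂u^k`. -/
def hamVec (l : Fin 2) (G : A) : A := rot (fun k => J.pd 0 k G) l

theorem evol_of_order_zero {G : A} (hG : ∀ k i, J.pd (k + 1) i G = 0) (v : Fin 2 → A) :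
    J.evol v G = ∑ i, v i * J.pd 0 i G := by
  rw [evol, J.field_eq_sum (n := 1) _ (fun k i hk => ?_)]
  · simp
  · obtain ⟨k, rfl⟩ : ∃ m, k = m + 1 := ⟨k - 1, by omega⟩
    exact hG k i

section Conditions

variable {g : Fin 2 → Fin 2 → A} {Γ : Fin 2 → Fin 2 → Fin 2 → A}
  (hg : ∀ i j k l, J.pd (k + 1) l (g i j) = 0)
  (hΓ : ∀ i j m k l, J.pd (k + 1) l (Γ i j m) = 0)

include hg hΓ in
theorem sum_single_lie (i j l : Fin 2) (a b c : A) :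
    ∑ p, (Pi.single i a : Fin 2 → A) p *
      J.lie (J.hydro g Γ) (J.second (Pi.single l c)) (Pi.single j b) p =
    a * (J.hamVec l (g i j) * J.D (J.D c) * J.D b +
      ((∑ k, J.hamVec l (Γ i j k) * J.coord 1 k) * J.D (J.D c) +
        rot (Γ i j) l * J.D (J.D (J.D c))) * b) := by
  simp only [lie_hydro, J.evol_of_order_zero (hg _ _), J.evol_of_order_zero (hΓ _ _ _)]
  fin_cases i <;> fin_cases j <;> fin_cases l <;>
    simp [second, hamVec, rot, Fin.sum_univ_two] <;> ring

include hg hΓ in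
/-- The mixed Jacobi identity, tested on `f = a(x) u^i`, `g = b(x) u^j` and a covector `c e_l`,
reads `∫ c W dx = 0` after `c` is freed from derivatives. The three conclusions are the vanishing of
the coefficients of `a' b''`, `a'' b'` and `a' b'` in `W`. -/
theorem jacobi_conditions (hP : J.IsPoisson (J.hydro g Γ)) (hQ : J.IsPoisson (J.pencil 1 1 g Γ))
    (i j l : Fin 2) :
    (2 * J.hamVec l (g i j) + J.hamVec j (g l i) = 3 * rot (Γ i j) l) ∧
    (J.hamVec l (g i j) - J.hamVec i (g j l) = 3 * rot (Γ i j) l) ∧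
    (J.D (J.hamVec l (g i j)) + ∑ k, J.hamVec l (Γ i j k) * J.coord 1 k =
      3 * J.D (rot (Γ i j) l)) := by
  set G := J.hamVec l (g i j) with hG
  set G' := J.hamVec i (g j l) with hG'
  set G'' := J.hamVec j (g l i) with hG''
  set K := rot (Γ i j) l with hK
  set K' := rot (Γ j l) i with hK'
  set K'' := rot (Γ l i) j with hK''
  set H := ∑ k, J.hamVec l (Γ i j k) * J.coord 1 k with hH
  set H' := ∑ k, J.hamVec i (Γ j l k) * J.coord 1 k with hH'
  set H'' := ∑ k, J.hamVec j (Γ l i k) * J.coord 1 k with hH''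
  -- `W = 0`, up to the terms in which `a` or `b` is not differentiated.
  have key : ∀ (r : ℝ) (m n : ℕ), ∃ X Y : A, ∀ a b,
      a = (J.x - algebraMap ℝ A r) ^ m → b = (J.x - algebraMap ℝ A r) ^ n →
      J.D (J.D a) * J.D b * (G - G' - 3 * K) + J.D a * J.D (J.D b) * (2 * G + G'' - 3 * K) +
        2 * (J.D a * J.D b) * (J.D G + H - 3 * J.D K) + a * X + b * Y = 0 := by
    intro r m n
    set a := (J.x - algebraMap ℝ A r) ^ m with ha
    set b := (J.x - algebraMap ℝ A r) ^ n with hb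
    have hW := J.eq_zero_of_forall_euler l
      (J.D (J.D (a * J.D b * G + a * b * H)) - J.D (J.D (J.D (K * a * b))) -
        J.D (b * G' * J.D (J.D a)) + b * (H' * J.D (J.D a) + K' * J.D (J.D (J.D a))) +
        G'' * J.D a * J.D (J.D b) + a * (H'' * J.D (J.D b) + K'' * J.D (J.D (J.D b))))
      (fun χ => ∑ p, (Pi.single i a : Fin 2 → A) p *
          J.lie (J.hydro g Γ) (J.second χ) (Pi.single j b) p +
        ∑ p, (Pi.single j b : Fin 2 → A) p *
          J.lie (J.hydro g Γ) (J.second (Pi.single i a)) χ p +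
        ∑ p, χ p * J.lie (J.hydro g Γ) (J.second (Pi.single j b)) (Pi.single i a) p)
      (fun c => by
        simp only [J.sum_single_lie hg hΓ]
        refine ⟨J.D c * (a * J.D b * G + a * b * H) - c * J.D (a * J.D b * G + a * b * H) +
          J.D (J.D c) * (K * a * b) - J.D c * J.D (K * a * b) + c * J.D (J.D (K * a * b)) +
          c * (b * G' * J.D (J.D a)), ?_⟩
        simp only [map_add, map_sub, Derivation.leibniz, smul_eq_mul]
        ring)
      (fun f => by
        have h := J.isNull_mixed_jacobi hP hQ (a * J.coord 0 i) (b * J.coord 0 j) f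
        rwa [euler_linear, euler_linear] at h)
    refine ⟨J.D (J.D (J.D b)) * G + 2 * J.D (J.D b) * J.D G + J.D b * J.D (J.D G) +
        J.D (J.D b) * H + 2 * J.D b * J.D H - (K * J.D (J.D (J.D b)) + 3 * J.D K * J.D (J.D b) +
        3 * J.D (J.D K) * J.D b) + H'' * J.D (J.D b) + K'' * J.D (J.D (J.D b)),
      J.D (J.D a) * H + 2 * J.D a * J.D H + a * J.D (J.D H) -
        (K * J.D (J.D (J.D a)) + 3 * J.D K * J.D (J.D a) +
        3 * J.D (J.D K) * J.D a + J.D (J.D (J.D K)) * a) - J.D G' * J.D (J.D a) -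
        G' * J.D (J.D (J.D a)) + H' * J.D (J.D a) + K' * J.D (J.D (J.D a)), ?_⟩
    rintro _ _ rfl rfl
    rw [← hW]
    clear_value a b G G' G'' K K' K'' H H' H''
    simp only [map_add, Derivation.leibniz, smul_eq_mul]
    ring
  have hD : ∀ r : ℝ, J.D (J.x - algebraMap ℝ A r) = 1 := fun r => by
    rw [map_sub, D_x, Derivation.map_algebraMap, sub_zero]
  have hD2 : ∀ r : ℝ, J.D ((J.x - algebraMap ℝ A r) ^ 2) = 2 * (J.x - algebraMap ℝ A r) :=
    fun r => by
      rw [Derivation.leibniz_pow, hD]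
      simp
  have hD3 : ∀ r : ℝ, J.D (2 * (J.x - algebraMap ℝ A r)) = 2 := fun r => by
    rw [Derivation.leibniz, hD, ← Nat.cast_ofNat, Derivation.map_natCast]
    simp
  -- At `x = r` the choices `(a, b) = (t, t²)`, `(t², t)`, `(t, t)` with `t = x - r` isolate the
  -- coefficients.
  have two : ∀ a : A, 2 * a = 0 → a = 0 := fun a h => by
    have : (2 : ℝ) • a = 0 := by rw [Algebra.smul_def, map_ofNat, h]
    simpa using this
  refine ⟨?_, ?_, ?_⟩
  · refine sub_eq_zero.1 (two _ (J.eq_zero_of_dvd _ fun r => ?_))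
    obtain ⟨X, Y, h⟩ := key r 1 2
    have h := h _ _ (pow_one _).symm rfl
    rw [hD2, hD3, hD, Derivation.map_one_eq_zero] at h
    exact ⟨-(4 * (J.D G + H - 3 * J.D K) + X + (J.x - algebraMap ℝ A r) * Y),
      by linear_combination h⟩
  · refine sub_eq_zero.1 (two _ (J.eq_zero_of_dvd _ fun r => ?_))
    obtain ⟨X, Y, h⟩ := key r 2 1
    have h := h _ _ rfl (pow_one _).symm
    rw [hD2, hD3, hD, Derivation.map_one_eq_zero] at h
    exact ⟨-(4 * (J.D G + H - 3 * J.D K) + (J.x - algebraMap ℝ A r) * X + Y),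
      by linear_combination h⟩
  · refine sub_eq_zero.1 (two _ (J.eq_zero_of_dvd _ fun r => ?_))
    obtain ⟨X, Y, h⟩ := key r 1 1
    have h := h _ _ (pow_one _).symm (pow_one _).symm
    rw [hD, Derivation.map_one_eq_zero] at h
    exact ⟨-(X + Y), by linear_combination h⟩

include hg hΓ in
/-- The conditions on `g` and `Γ`, solved: `∂_k g^{ij} = (δ^i_k c^j + δ^j_k c^i) / 2` and
`Γ^{ij}_k = δ^i_k c^j / 2` with `c^j = ∂_j g^{jj}` constant. -/
theorem conditions_of_isPoisson (hP : J.IsPoisson (J.hydro g Γ))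
    (hQ : J.IsPoisson (J.pencil 1 1 g Γ)) :
    (∀ i j, g i j = g j i) ∧
    (∀ i j k, J.pd 0 k (g i j) = (if i = k then (1 / 2 : ℝ) • J.pd 0 j (g j j) else 0) +
      (if j = k then (1 / 2 : ℝ) • J.pd 0 i (g i i) else 0)) ∧
    (∀ i j k, Γ i j k = if i = k then (1 / 2 : ℝ) • J.pd 0 j (g j j) else 0) ∧
    (∀ j k, J.pd 0 k (J.pd 0 j (g j j)) = 0) := by
  have hpd : ∀ {G : A}, (∀ k l, J.pd (k + 1) l G = 0) → ∀ k, J.pd 1 k (J.D G) = J.pd 0 k G := by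
    intro G hG k
    rw [pd_succ_D, hG, map_zero, zero_add]
  have hpd2 : ∀ {G : A}, (∀ k l, J.pd (k + 1) l G = 0) → ∀ i k l, J.pd (k + 1) l (J.pd 0 i G) = 0 :=
    fun hG i k l => by rw [J.pd_comm, hG, map_zero]
  have h10 : g 1 0 = g 0 1 := (J.hydro_skew hP 1 0).1
  have c := J.jacobi_conditions hg hΓ hP hQ
  obtain ⟨a000, b000, -⟩ := c 0 0 0
  obtain ⟨a111, b111, -⟩ := c 1 1 1
  obtain ⟨a001, b001, -⟩ := c 0 0 1
  obtain ⟨a110, b110, -⟩ := c 1 1 0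
  obtain ⟨a010, -, e010⟩ := c 0 1 0
  obtain ⟨a101, -, e101⟩ := c 1 0 1
  have a100 := (c 1 0 0).1
  have a011 := (c 0 1 1).1
  simp only [hamVec, rot, h10, Fin.sum_univ_two, Matrix.cons_val_zero, Matrix.cons_val_one,
    map_neg] at a000 b000 a111 b111 a001 b001 a110 b110 a010 e010 a101 e101 a100 a011
  have three : ∀ {a b : A}, 3 * a = 3 * b → a = b := fun {a b} h => by
    have : (3 : ℝ) • (a - b) = 0 := by
      rw [Algebra.smul_def, map_ofNat, mul_sub, h, sub_self]
    exact sub_eq_zero.1 (by simpa using this)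
  have half : ∀ {a b : A}, b = 2 * a → a = (1 / 2 : ℝ) • b := fun {a b} h => by
    rw [h, ← map_ofNat (algebraMap ℝ A) 2, ← Algebra.smul_def, smul_smul]
    norm_num
  have G001 : Γ 0 0 1 = 0 := three (by linear_combination b000)
  have G110 : Γ 1 1 0 = 0 := three (by linear_combination -b111)
  have d001 : J.pd 0 1 (g 0 0) = 0 := three (by linear_combination b000 - a000)
  have d110 : J.pd 0 0 (g 1 1) = 0 := three (by linear_combination a111 - b111)
  have d000 : J.pd 0 0 (g 0 0) = 2 * J.pd 0 1 (g 0 1) := by linear_combination a001 - b001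
  have d111 : J.pd 0 1 (g 1 1) = 2 * J.pd 0 0 (g 0 1) := by linear_combination b110 - a110
  have G000 : Γ 0 0 0 = J.pd 0 1 (g 0 1) := three (by linear_combination d000 - b001)
  have G111 : Γ 1 1 1 = J.pd 0 0 (g 0 1) := three (by linear_combination d111 + b110)
  have G011 : Γ 0 1 1 = 0 := three (by linear_combination a010 - d000)
  have G100 : Γ 1 0 0 = 0 := three (by linear_combination -d111 - a101)
  have G101 : Γ 1 0 1 = J.pd 0 1 (g 0 1) := three (by linear_combination a100)
  have G010 : Γ 0 1 0 = J.pd 0 0 (g 0 1) := three (by linear_combination -a011)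
  rw [G011, G010] at e010
  rw [G100, G101] at e101
  -- Comparing the coefficients of `u^k_x` in the third condition gives that `c` is constant.
  have e010 := congrArg (J.pd 1 0) e010
  have e101 := congrArg (J.pd 1 1) e101
  have hz : ∀ i j l, J.pd 1 l (J.pd 0 i (J.pd 0 j (g 0 1))) = 0 :=
    fun i j l => hpd2 (hpd2 (hg 0 1) j) i 0 l
  simp only [map_add, map_neg, map_zero, neg_zero, mul_zero, Derivation.leibniz, smul_eq_mul,
    hpd (hpd2 (hg _ _) _), J.pd_coord, and_true, if_true, mul_one, add_zero, zero_add,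
    zero_mul, hz] at e010 e101
  have z01 : J.pd 0 0 (J.pd 0 1 (g 0 1)) = 0 := by
    have : (2 : ℝ) • J.pd 0 0 (J.pd 0 1 (g 0 1)) = 0 := by
      rw [J.pd_comm 0 1] at e101
      rw [Algebra.smul_def, map_ofNat]
      linear_combination e101
    simpa using this
  have z10 : J.pd 0 1 (J.pd 0 0 (g 0 1)) = 0 := by rw [J.pd_comm, z01]
  have hnat : ∀ k i, J.pd k i (2 : A) = 0 := fun k i => by
    rw [← map_ofNat (algebraMap ℝ A), Derivation.map_algebraMap]
  refine ⟨?_, ?_, ?_, ?_⟩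
  · intro i j
    exact (J.hydro_skew hP i j).1
  · intro i j k
    fin_cases i <;> fin_cases j <;> fin_cases k <;>
      simp only [Fin.zero_eta, Fin.mk_one, d001, d110, h10, half d000, half d111, zero_ne_one,
        one_ne_zero, if_true, if_false, add_zero, zero_add] <;> module
  · intro i j k
    fin_cases i <;> fin_cases j <;> fin_cases k <;>
      simp only [Fin.zero_eta, Fin.mk_one, G000, G001, G010, G011, G100, G101, G110, G111,
        half d000, half d111, zero_ne_one, one_ne_zero, if_true, if_false]
  · intro j k
    fin_cases j <;> fin_cases k
    · simp [d000, z01, hnat]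
    · simp [J.pd_comm 0 1, d001]
    · simp [J.pd_comm 0 0 0 1, d110]
    · simp [d111, z10, hnat]

end Conditions

end JetCalculus

open TopologicalSpace

/-! ### The ring of differential functions -/

/-- The jets over `U`. -/
abbrev JetOver (U : Opens (Fin 2 → ℝ)) : Type := {p : Jet // p.val ∈ U}

/-- The projection to the jets of order `n`. -/
def truncate (n : ℕ) : Jet →ₗ[ℝ] ℝ × (Fin (n + 1) × Fin 2 → ℝ) where
  toFun p := (p.1, fun a => p.2 (a.1, a.2))
  map_add' _ _ := rfl
  map_smul' _ _ := rfl

/-- The jets of order `n` over `U`. -/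
def finiteJets (U : Opens (Fin 2 → ℝ)) (n : ℕ) : Set (ℝ × (Fin (n + 1) × Fin 2 → ℝ)) :=
  {q | (fun i => q.2 (0, i)) ∈ (U : Set (Fin 2 → ℝ))}

variable {U : Opens (Fin 2 → ℝ)}

theorem isOpen_finiteJets (n : ℕ) : IsOpen (finiteJets U n) :=
  U.isOpen.preimage (by fun_prop)

theorem truncate_mem {p : Jet} (n : ℕ) (hp : p.val ∈ U) : truncate n p ∈ finiteJets U n := hp

/-- `f` is a smooth function of the jets of order `n`. -/
def HasOrder (n : ℕ) (f : JetOver U → ℝ) : Prop :=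
  ∃ F : ℝ × (Fin (n + 1) × Fin 2 → ℝ) → ℝ,
    ContDiffOn ℝ ∞ F (finiteJets U n) ∧ ∀ p, f p = F (truncate n p)

theorem HasOrder.mono {n m : ℕ} (hnm : n ≤ m) {f : JetOver U → ℝ} (hf : HasOrder n f) :
    HasOrder m f := by
  obtain ⟨F, hF, h⟩ := hf
  refine ⟨fun q => F (q.1, fun a => q.2 (Fin.castLE (by omega) a.1, a.2)), ?_, fun p => h p⟩
  refine hF.comp (t := finiteJets U n) ?_ fun q hq => hq
  fun_prop

/-- The algebra of differential functions over `U`. -/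
def DiffFun (U : Opens (Fin 2 → ℝ)) : Subalgebra ℝ (JetOver U → ℝ) where
  carrier := {f | ∃ n, HasOrder n f}
  mul_mem' := by
    rintro f g ⟨n, hf⟩ ⟨m, hg⟩
    obtain ⟨F, hF, hf⟩ := hf.mono (le_max_left n m)
    obtain ⟨G, hG, hg⟩ := hg.mono (le_max_right n m)
    exact ⟨max n m, fun q => F q * G q, hF.mul hG, fun p => by rw [Pi.mul_apply, hf, hg]⟩
  add_mem' := by
    rintro f g ⟨n, hf⟩ ⟨m, hg⟩
    obtain ⟨F, hF, hf⟩ := hf.mono (le_max_left n m)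
    obtain ⟨G, hG, hg⟩ := hg.mono (le_max_right n m)
    exact ⟨max n m, fun q => F q + G q, hF.add hG, fun p => by rw [Pi.add_apply, hf, hg]⟩
  algebraMap_mem' r := ⟨0, fun _ => r, contDiffOn_const, fun _ => rfl⟩

/-- Evaluation at a jet. -/
def evalAt (p : JetOver U) : DiffFun U →ₐ[ℝ] ℝ :=
  (Pi.evalAlgHom ℝ (fun _ : JetOver U => ℝ) p).comp (DiffFun U).val

theorem ext_evalAt {a b : DiffFun U} (h : ∀ p, evalAt p a = evalAt p b) : a = b :=
  Subtype.ext (funext h)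

/-- `f` agrees with `a` over `U`; the values of `f` elsewhere are irrelevant. -/
def Rep (f : JetFun) (a : DiffFun U) : Prop :=
  ∀ p : Jet, ∀ h : p.val ∈ U, f p = evalAt ⟨p, h⟩ a

/-- Extension by zero. -/
def extend (a : DiffFun U) : JetFun :=
  open Classical in fun p => if h : p.val ∈ U then evalAt ⟨p, h⟩ a else 0

theorem rep_extend (a : DiffFun U) : Rep (extend a) a := fun p h => by
  rw [extend, dif_pos h]

theorem isDensity_iff {f : JetFun} : IsDensity U f ↔ ∃ a : DiffFun U, Rep f a := by
  constructor
  · rintro ⟨n, F, hF, h⟩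
    exact ⟨⟨fun p => f p, n, F, hF, fun p => h p p.2⟩, fun p h => rfl⟩
  · rintro ⟨⟨a, n, F, hF, h⟩, ha⟩
    exact ⟨n, F, hF, fun p hp => (ha p hp).trans (h ⟨p, hp⟩)⟩

theorem hasLineDerivAt_of_eq_truncate {n : ℕ} {F : ℝ × (Fin (n + 1) × Fin 2 → ℝ) → ℝ}
    (hF : ContDiffOn ℝ ∞ F (finiteJets U n)) {f : JetFun}
    (hf : ∀ p : Jet, p.val ∈ U → f p = F (truncate n p)) {p : Jet} (hp : p.val ∈ U) (v : Jet) :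
    HasLineDerivAt ℝ f (fderiv ℝ F (truncate n p) (truncate n v)) p v := by
  have hd : DifferentiableAt ℝ F (truncate n p) :=
    (hF.contDiffAt ((isOpen_finiteJets n).mem_nhds (truncate_mem n hp))).differentiableAt
      (by simp)
  have h1 := hd.hasFDerivAt.hasLineDerivAt (truncate n v)
  refine HasDerivAt.congr_of_eventuallyEq h1 ?_
  have hc : Continuous fun t : ℝ => (p + t • v).val := by
    have : (fun t : ℝ => (p + t • v).val) = fun t i => p.2 (0, i) + t * v.2 (0, i) := rfl
    rw [this]
    fun_prop
  have hm : ∀ᶠ t : ℝ in nhds 0, (p + t • v).val ∈ U :=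
    hc.continuousAt.eventually_mem (U.isOpen.mem_nhds (by simpa using hp))
  filter_upwards [hm] with t ht
  rw [hf _ ht, map_add, map_smul]

theorem Rep.hasLineDerivAt {f : JetFun} {a : DiffFun U} (h : Rep f a) {p : Jet}
    (hp : p.val ∈ U) (v : Jet) : HasLineDerivAt ℝ f (lineDeriv ℝ f p v) p v := by
  obtain ⟨a, n, F, hF, ha⟩ := a
  have := hasLineDerivAt_of_eq_truncate hF (fun p hp => (h p hp).trans (ha ⟨p, hp⟩)) hp v
  exact this.lineDifferentiableAt.hasLineDerivAt

theorem Rep.lineDeriv_eq {f : JetFun} {a : DiffFun U} (h : Rep f a) {n : ℕ}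
    {F : ℝ × (Fin (n + 1) × Fin 2 → ℝ) → ℝ} (hF : ContDiffOn ℝ ∞ F (finiteJets U n))
    (ha : ∀ p, evalAt p a = F (truncate n p)) {p : Jet} (hp : p.val ∈ U) (v : Jet) :
    lineDeriv ℝ f p v = fderiv ℝ F (truncate n p) (truncate n v) :=
  (hasLineDerivAt_of_eq_truncate hF (fun p hp => (h p hp).trans (ha ⟨p, hp⟩)) hp v).lineDeriv

theorem contDiffOn_fderiv_apply {n : ℕ} {F : ℝ × (Fin (n + 1) × Fin 2 → ℝ) → ℝ}
    (hF : ContDiffOn ℝ ∞ F (finiteJets U n)) (w : ℝ × (Fin (n + 1) × Fin 2 → ℝ)) :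
    ContDiffOn ℝ ∞ (fun q => fderiv ℝ F q w) (finiteJets U n) :=
  (hF.fderiv_of_isOpen (isOpen_finiteJets n) (by simp)).clm_apply contDiffOn_const

/-- The derivative in the direction `v` of the jet space. -/
def dirDeriv (v : Jet) : Derivation ℝ (DiffFun U) (DiffFun U) :=
  Derivation.mk'
    { toFun := fun a => ⟨fun p => lineDeriv ℝ (extend a) p v, by
        obtain ⟨n, F, hF, ha⟩ := a.2
        exact ⟨n, _, contDiffOn_fderiv_apply hF (truncate n v),
          fun p => (rep_extend a).lineDeriv_eq hF ha p.2 v⟩⟩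
      map_add' := fun a b => ext_evalAt fun p => by
        have h1 : extend (a + b) = fun q => extend a q + extend b q := by
          funext q
          by_cases hq : q.val ∈ U <;> simp [extend, hq]
        have h2 := (rep_extend a).hasLineDerivAt p.2 v
        have h3 := (rep_extend b).hasLineDerivAt p.2 v
        exact (congrArg (fun f => lineDeriv ℝ f p.1 v) h1).trans (HasDerivAt.fun_add h2 h3).deriv
      map_smul' := fun r a => ext_evalAt fun p => by
        have h1 : extend (r • a) = fun q => r • extend a q := by
          funext q
          by_cases hq : q.val ∈ U <;> simp [extend, hq]
        have h2 := (rep_extend a).hasLineDerivAt p.2 v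
        exact (congrArg (fun f => lineDeriv ℝ f p.1 v) h1).trans
          (HasDerivAt.fun_const_smul r h2).deriv }
    fun a b => ext_evalAt fun p => by
      have h1 : extend (a * b) = fun q => extend a q * extend b q := by
        funext q
        by_cases hq : q.val ∈ U <;> simp [extend, hq]
      have h2 := (rep_extend a).hasLineDerivAt p.2 v
      have h3 := (rep_extend b).hasLineDerivAt p.2 v
      refine (congrArg (fun f => lineDeriv ℝ f p.1 v) h1).trans
        ((HasDerivAt.fun_mul h2 h3).deriv.trans ?_)
      simp only [zero_smul, add_zero, rep_extend a p.1 p.2, rep_extend b p.1 p.2]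
      rw [add_comm, mul_comm (lineDeriv ℝ (extend a) p.1 v)]
      rfl

theorem Rep.dirDeriv {f : JetFun} {a : DiffFun U} (h : Rep f a) (v : Jet) :
    Rep (fun p => lineDeriv ℝ f p v) (dirDeriv v a) := fun p hp => by
  obtain ⟨n, F, hF, ha⟩ := a.2
  exact (h.lineDeriv_eq hF ha hp v).trans ((rep_extend a).lineDeriv_eq hF ha hp v).symm

theorem evalAt_dirDeriv {a : DiffFun U} {n : ℕ} {F : ℝ × (Fin (n + 1) × Fin 2 → ℝ) → ℝ}
    (hF : ContDiffOn ℝ ∞ F (finiteJets U n)) (ha : ∀ p, evalAt p a = F (truncate n p))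
    (v : Jet) (p : JetOver U) :
    evalAt p (dirDeriv v a) = fderiv ℝ F (truncate n p) (truncate n v) :=
  (rep_extend a).lineDeriv_eq hF ha p.2 v

theorem dirDeriv_comm (v w : Jet) (a : DiffFun U) :
    dirDeriv v (dirDeriv w a) = dirDeriv w (dirDeriv v a) := by
  obtain ⟨n, F, hF, ha⟩ := a.2
  refine ext_evalAt fun p => ?_
  have hFp := hF.contDiffAt ((isOpen_finiteJets n).mem_nhds (truncate_mem n p.2))
  have hs := hFp.isSymmSndFDerivAt (by
    rw [minSmoothness_of_isRCLikeNormedField]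
    exact WithTop.coe_le_coe.2 le_top)
  have hd : DifferentiableAt ℝ (fderiv ℝ F) (truncate n p) :=
    ((hF.fderiv_of_isOpen (m := ∞) (isOpen_finiteJets n) (by simp)).contDiffAt
      ((isOpen_finiteJets n).mem_nhds (truncate_mem n p.2))).differentiableAt (by simp)
  have key : ∀ v w : Jet, evalAt p (dirDeriv v (dirDeriv w a)) =
      fderiv ℝ (fderiv ℝ F) (truncate n p) (truncate n v) (truncate n w) := by
    intro v w
    rw [evalAt_dirDeriv (contDiffOn_fderiv_apply hF (truncate n w)) (evalAt_dirDeriv hF ha w),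
      fderiv_clm_apply hd (differentiableAt_const _)]
    simp
  rw [key, key, hs.eq]

/-- The independent variable `x`. -/
def xFun (U : Opens (Fin 2 → ℝ)) : DiffFun U :=
  ⟨fun p => p.1.1, 0, fun q => q.1, by fun_prop, fun _ => rfl⟩

/-- The jet coordinate `u^i_{(k)}`. -/
def coordFun (U : Opens (Fin 2 → ℝ)) (k : ℕ) (i : Fin 2) : DiffFun U :=
  ⟨fun p => p.1.2 (k, i), k, fun q => q.2 (Fin.last k, i), by fun_prop, fun _ => rfl⟩

theorem dirDeriv_xFun (v : Jet) : dirDeriv v (xFun U) = algebraMap ℝ _ v.1 := by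
  refine ext_evalAt fun p => ?_
  have h := HasFDerivAt.fderiv
    (hasFDerivAt_fst (𝕜 := ℝ) (p := (truncate 0 p.1 : ℝ × (Fin (0 + 1) × Fin 2 → ℝ))))
  rw [evalAt_dirDeriv (n := 0) (F := Prod.fst) (by fun_prop) (fun _ => rfl), h]
  rfl

theorem dirDeriv_coordFun (v : Jet) (k : ℕ) (i : Fin 2) :
    dirDeriv v (coordFun U k i) = algebraMap ℝ _ (v.2 (k, i)) := by
  refine ext_evalAt fun p => ?_
  have h : HasFDerivAt (fun q : ℝ × (Fin (k + 1) × Fin 2 → ℝ) => q.2 (Fin.last k, i))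
      ((ContinuousLinearMap.proj (Fin.last k, i)).comp (ContinuousLinearMap.snd ℝ _ _))
      (truncate k p.1) := ((ContinuousLinearMap.proj (R := ℝ) (φ := fun _ => ℝ)
        (Fin.last k, i)).comp (ContinuousLinearMap.snd ℝ ℝ _)).hasFDerivAt
  rw [evalAt_dirDeriv (n := k) (F := fun q => q.2 (Fin.last k, i)) (by fun_prop) (fun _ => rfl),
    h.fderiv]
  rfl

/-- The direction of the coordinate `u^i_{(k)}`. -/
def jetDir (k : ℕ) (i : Fin 2) : Jet := (0, Pi.single (k, i) 1)

theorem truncate_jetDir {n k : ℕ} (h : n < k) (i : Fin 2) : truncate n (jetDir k i) = 0 := by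
  refine Prod.ext rfl (funext fun a => ?_)
  refine Pi.single_eq_of_ne (fun h' => ?_) _
  have := congrArg Prod.fst h'
  have := a.1.2
  simp only at *
  omega

/-- The differential functions over `U`, with their partial derivatives. -/
def diffCalculus (U : Opens (Fin 2 → ℝ)) : JetCalculus (DiffFun U) where
  pdx := dirDeriv (1, 0)
  pd k i := dirDeriv (jetDir k i)
  x := xFun U
  coord := coordFun U
  exists_order a := by
    obtain ⟨n, F, hF, ha⟩ := a.2
    refine ⟨n + 1, fun k i hk => ext_evalAt fun p => ?_⟩
    rw [evalAt_dirDeriv hF ha, truncate_jetDir (by omega), map_zero, map_zero]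
  pd_comm _ _ _ _ _ := dirDeriv_comm _ _ _
  pd_pdx _ _ _ := dirDeriv_comm _ _ _
  pd_x k i := by rw [dirDeriv_xFun]; simp [jetDir]
  pdx_x := by rw [dirDeriv_xFun]; simp
  pd_coord k i l j := by
    rw [dirDeriv_coordFun]
    by_cases h : k = l ∧ i = j
    · simp [h, jetDir]
    · have : (jetDir k i).2 (l, j) = 0 :=
        Pi.single_eq_of_ne (fun h' => h ⟨(Prod.ext_iff.1 h').1.symm, (Prod.ext_iff.1 h').2.symm⟩) _
      rw [if_neg h, this, map_zero]
  pdx_coord l j := by rw [dirDeriv_coordFun]; simp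
  eq_zero_of_dvd a h := ext_evalAt fun p => by
    obtain ⟨b, hb⟩ := h p.1.1
    rw [hb, map_mul, map_sub, map_zero, AlgHom.commutes]
    have : evalAt p (xFun U) = p.1.1 := rfl
    rw [this]
    simp

/-! ### Brackets of densities and of differential functions -/

theorem Rep.pd {f : JetFun} {a : DiffFun U} (h : Rep f a) (k : ℕ) (i : Fin 2) :
    Rep (pd k i f) ((diffCalculus U).pd k i a) :=
  h.dirDeriv _

theorem Rep.totalD {f : JetFun} {a : DiffFun U} (h : Rep f a) :
    Rep (totalD f) ((diffCalculus U).D a) := fun p hp => by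
  obtain ⟨n, hn⟩ := (diffCalculus U).exists_order a
  have h1 : ∀ k i, LocalPoisson.pd k i f p = evalAt ⟨p, hp⟩ ((diffCalculus U).pd k i a) :=
    fun k i => h.pd k i p hp
  have h2 : pdx f p = evalAt ⟨p, hp⟩ ((diffCalculus U).pdx a) := h.dirDeriv (1, 0) p hp
  rw [LocalPoisson.totalD, JetCalculus.D, Derivation.add_apply, map_add, h2,
    (diffCalculus U).field_eq_sum _ hn,
    finsum_eq_sum_of_support_subset (s := Finset.range n ×ˢ Finset.univ), Finset.sum_product]
  · simp only [map_sum, map_mul, h1]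
    congr 1
    refine Finset.sum_congr rfl fun k _ => Finset.sum_congr rfl fun i _ => mul_comm _ _
  · rintro ⟨k, i⟩ hk
    by_contra hc
    simp only [Finset.coe_product, Finset.coe_range, Finset.coe_univ, Set.mem_prod, Set.mem_Iio,
      Set.mem_univ, and_true, not_lt] at hc
    exact hk (by simp only [h1, hn k i hc, map_zero, zero_mul])

theorem Rep.iterate_totalD {f : JetFun} {a : DiffFun U} (h : Rep f a) (k : ℕ) :
    Rep (LocalPoisson.totalD^[k] f) ((diffCalculus U).D^[k] a) := by
  induction k with
  | zero => exact h
  | succ k ih =>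
    rw [Function.iterate_succ_apply', Function.iterate_succ_apply']
    exact ih.totalD

theorem Rep.varDeriv {f : JetFun} {a : DiffFun U} (h : Rep f a) (i : Fin 2) :
    Rep (varDeriv f i) ((diffCalculus U).euler a i) := fun p hp => by
  obtain ⟨n, hn⟩ := (diffCalculus U).exists_order a
  have h1 : ∀ k, (LocalPoisson.totalD^[k] (LocalPoisson.pd k i f)) p =
      evalAt ⟨p, hp⟩ ((diffCalculus U).D^[k] ((diffCalculus U).pd k i a)) :=
    fun k => (h.pd k i).iterate_totalD k p hp
  rw [LocalPoisson.varDeriv, (diffCalculus U).euler_eq_sum hn,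
    JetCalculus.finsum_eq_sum_range (n := n)]
  · simp only [map_sum, map_mul, map_pow, map_neg, map_one, h1]
  · intro k hk
    rw [h1, hn k i hk, iterate_map_zero, map_zero, mul_zero]

theorem Rep.add {f g : JetFun} {a b : DiffFun U} (hf : Rep f a) (hg : Rep g b) :
    Rep (f + g) (a + b) := fun p hp => by
  rw [Pi.add_apply, map_add, hf p hp, hg p hp]

theorem Rep.mul {f g : JetFun} {a b : DiffFun U} (hf : Rep f a) (hg : Rep g b) :
    Rep (f * g) (a * b) := fun p hp => by
  rw [Pi.mul_apply, map_mul, hf p hp, hg p hp]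

theorem Rep.sum {ι : Type*} (s : Finset ι) {f : ι → JetFun} {a : ι → DiffFun U}
    (h : ∀ i, Rep (f i) (a i)) : Rep (∑ i ∈ s, f i) (∑ i ∈ s, a i) := fun p hp => by
  rw [Finset.sum_apply, map_sum]
  exact Finset.sum_congr rfl fun i _ => h i p hp

theorem Rep.isNullFunctional_iff {f : JetFun} {a : DiffFun U} (h : Rep f a) :
    IsNullFunctional U f ↔ (diffCalculus U).IsNull a := by
  constructor
  · rintro ⟨k, hk, hf⟩
    obtain ⟨b, hb⟩ := isDensity_iff.1 hk
    refine ⟨b, ext_evalAt fun p => ?_⟩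
    rw [← h p.1 p.2, ← hb.totalD p.1 p.2, hf p.1 p.2]
  · rintro ⟨b, rfl⟩
    refine ⟨extend b, isDensity_iff.2 ⟨b, rep_extend b⟩, fun p hp => ?_⟩
    rw [h p hp, (rep_extend b).totalD p hp]

/-- `P` acts on differential functions over `U` as the operator `Q`. -/
def RepOp (P : MatDiffOp) (Q : (Fin 2 → DiffFun U) → Fin 2 → DiffFun U) : Prop :=
  ∀ (ψ : Fin 2 → JetFun) (a : Fin 2 → DiffFun U), (∀ j, Rep (ψ j) (a j)) →
    ∀ i, Rep (P.act ψ i) (Q a i)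

theorem RepOp.bracket {P : MatDiffOp} {Q : (Fin 2 → DiffFun U) → Fin 2 → DiffFun U}
    (hP : RepOp P Q) {f g : JetFun} {a b : DiffFun U} (hf : Rep f a) (hg : Rep g b) :
    Rep (bracket P f g) ((diffCalculus U).bracket Q a b) :=
  Rep.sum _ fun i => (hf.varDeriv i).mul (hP _ _ hg.varDeriv i)

/-- `IsHamiltonian` is a statement about the differential algebra `DiffFun U`. -/
theorem RepOp.isHamiltonian_iff {P : MatDiffOp} {Q : (Fin 2 → DiffFun U) → Fin 2 → DiffFun U}
    (hP : RepOp P Q) : IsHamiltonian U P ↔ (diffCalculus U).IsPoisson Q := by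
  have skew : ∀ {f g : JetFun} {a b : DiffFun U}, Rep f a → Rep g b →
      Rep (LocalPoisson.bracket P f g + LocalPoisson.bracket P g f) _ :=
    fun hf hg => (hP.bracket hf hg).add (hP.bracket hg hf)
  have jacobi : ∀ {f g h : JetFun} {a b c : DiffFun U}, Rep f a → Rep g b → Rep h c →
      Rep (LocalPoisson.bracket P (LocalPoisson.bracket P f g) h +
        LocalPoisson.bracket P (LocalPoisson.bracket P g h) f +
        LocalPoisson.bracket P (LocalPoisson.bracket P h f) g) _ :=
    fun hf hg hh => ((hP.bracket (hP.bracket hf hg) hh).add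
      (hP.bracket (hP.bracket hg hh) hf)).add (hP.bracket (hP.bracket hh hf) hg)
  constructor
  · rintro ⟨h1, h2⟩
    have hd : ∀ a : DiffFun U, IsDensity U (extend a) :=
      fun a => isDensity_iff.2 ⟨a, rep_extend a⟩
    exact ⟨fun a b => (skew (rep_extend a) (rep_extend b)).isNullFunctional_iff.1
        (h1 _ _ (hd a) (hd b)),
      fun a b c => (jacobi (rep_extend a) (rep_extend b) (rep_extend c)).isNullFunctional_iff.1
        (h2 _ _ _ (hd a) (hd b) (hd c))⟩
  · rintro ⟨h1, h2⟩
    refine ⟨fun f g hf hg => ?_, fun f g h hf hg hh => ?_⟩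
    · obtain ⟨a, hf⟩ := isDensity_iff.1 hf
      obtain ⟨b, hg⟩ := isDensity_iff.1 hg
      exact (skew hf hg).isNullFunctional_iff.2 (h1 a b)
    · obtain ⟨a, hf⟩ := isDensity_iff.1 hf
      obtain ⟨b, hg⟩ := isDensity_iff.1 hg
      obtain ⟨c, hh⟩ := isDensity_iff.1 hh
      exact (jacobi hf hg hh).isNullFunctional_iff.2 (h2 a b c)

theorem act_pencil (s t : ℝ) (g : (Fin 2 → ℝ) → Matrix (Fin 2) (Fin 2) ℝ)
    (Γ : (Fin 2 → ℝ) → Fin 2 → Fin 2 → Fin 2 → ℝ) (ψ : Fin 2 → JetFun) (i : Fin 2) (p : Jet) :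
    (s • hydroOp g Γ + t • R2).act ψ i p =
      s * ∑ j, (g p.val i j * totalD (ψ j) p + (∑ k, Γ p.val i j k * p.2 (1, k)) * ψ j p) +
      t * ![totalD (totalD (ψ 1)) p, -totalD (totalD (ψ 0)) p] i := by
  have h0 : ∀ l : ℕ, ∑ j, (0 : Matrix (Fin 2) (Fin 2) JetFun) i j * totalD^[l] (ψ j) = 0 := by
    simp
  have hadd : ∀ (l : ℕ) (B C : Matrix (Fin 2) (Fin 2) JetFun),
      ∑ j, (B + C) i j * totalD^[l] (ψ j) =
        ∑ j, B i j * totalD^[l] (ψ j) + ∑ j, C i j * totalD^[l] (ψ j) := fun l B C => by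
    simp only [Matrix.add_apply, add_mul, Finset.sum_add_distrib]
  rw [MatDiffOp.act, hydroOp, R2, smul_add, Finsupp.smul_single, Finsupp.smul_single,
    Finsupp.smul_single, Finsupp.sum_add_index' h0 hadd, Finsupp.sum_add_index' h0 hadd,
    Finsupp.sum_single_index (h0 _), Finsupp.sum_single_index (h0 _),
    Finsupp.sum_single_index (h0 _)]
  fin_cases i <;> simp [Fin.sum_univ_two] <;> ring

theorem repOp_pencil (s t : ℝ) {g : (Fin 2 → ℝ) → Matrix (Fin 2) (Fin 2) ℝ}
    {Γ : (Fin 2 → ℝ) → Fin 2 → Fin 2 → Fin 2 → ℝ} {g' : Fin 2 → Fin 2 → DiffFun U}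
    {Γ' : Fin 2 → Fin 2 → Fin 2 → DiffFun U} (hg : ∀ i j, Rep (fun p => g p.val i j) (g' i j))
    (hΓ : ∀ i j k, Rep (fun p => Γ p.val i j k) (Γ' i j k)) :
    RepOp (s • hydroOp g Γ + t • R2) ((diffCalculus U).pencil s t g' Γ') := by
  intro ψ a h i p hp
  have hc : ∀ k, evalAt ⟨p, hp⟩ ((diffCalculus U).coord 1 k) = p.2 (1, k) := fun k => rfl
  rw [act_pencil, JetCalculus.pencil, map_add, map_smul, map_smul, JetCalculus.hydro]
  simp only [map_sum, map_add, map_mul, hc, smul_eq_mul, ← hg _ _ p hp, ← hΓ _ _ _ p hp,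
    ← h _ p hp, ← (h _).totalD p hp]
  congr 2
  fin_cases i <;> simp [JetCalculus.second, ← (h _).totalD.totalD p hp]

/-! ### Functions of `u` -/

/-- A smooth function of `u` as a differential function. -/
def ofFun (G : (Fin 2 → ℝ) → ℝ) (hG : ContDiffOn ℝ ∞ G U) : DiffFun U :=
  ⟨fun p => G p.1.val, 0, fun q => G fun i => q.2 (0, i),
    hG.comp (s := finiteJets U 0) (by fun_prop) fun _ hq => hq, fun _ => rfl⟩

theorem rep_ofFun (G : (Fin 2 → ℝ) → ℝ) (hG : ContDiffOn ℝ ∞ G U) :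
    Rep (fun p => G p.val) (ofFun G hG) := fun _ _ => rfl

theorem pd_succ_ofFun (G : (Fin 2 → ℝ) → ℝ) (hG : ContDiffOn ℝ ∞ G U) (k : ℕ) (i : Fin 2) :
    (diffCalculus U).pd (k + 1) i (ofFun G hG) = 0 := by
  refine ext_evalAt fun p => ?_
  refine ((rep_ofFun G hG).dirDeriv (jetDir (k + 1) i) p.1 p.2).symm.trans ?_
  have : ∀ t : ℝ, (p.1 + t • jetDir (k + 1) i).val = p.1.val := fun t => by
    funext j
    simp [Jet.val, jetDir]
  simp [lineDeriv, this]

theorem evalAt_pd_zero_ofFun (G : (Fin 2 → ℝ) → ℝ) (hG : ContDiffOn ℝ ∞ G U) (i : Fin 2)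
    (p : JetOver U) :
    evalAt p ((diffCalculus U).pd 0 i (ofFun G hG)) = partialU i G p.1.val := by
  refine ((rep_ofFun G hG).dirDeriv (jetDir 0 i) p.1 p.2).symm.trans ?_
  have : ∀ t : ℝ, (p.1 + t • jetDir 0 i).val = p.1.val + t • Pi.single i 1 := fun t => by
    funext j
    by_cases h : j = i <;> simp [Jet.val, jetDir, h]
  simp [lineDeriv, partialU, this]

/-! ### The metrics of the family -/

/-- The derivative of the inverse matrix, `-M⁻¹ N M⁻¹`. -/
theorem hasDerivAt_inv_add_smul (M N : Matrix (Fin 2) (Fin 2) ℝ) (hM : M.det ≠ 0) (i j : Fin 2) :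
    HasDerivAt (fun t : ℝ => (M + t • N)⁻¹ i j) (-(M⁻¹ * N * M⁻¹) i j) 0 := by
  have he : ∀ i j, HasDerivAt (fun t : ℝ => M i j + t * N i j) (N i j) 0 := fun i j => by
    simpa using ((hasDerivAt_id (0 : ℝ)).mul_const (N i j)).const_add (M i j)
  have hd := (((he 0 0).fun_mul (he 1 1)).fun_sub ((he 0 1).fun_mul (he 1 0))).fun_inv
    (by simpa [Matrix.det_fin_two] using hM)
  rw [Matrix.det_fin_two] at hM
  simp only [Matrix.inv_def, Ring.inverse_eq_inv', Matrix.det_fin_two, Matrix.adjugate_fin_two,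
    Matrix.smul_apply, Matrix.add_apply, Matrix.mul_apply, Fin.sum_univ_two, smul_eq_mul]
  fin_cases i <;> fin_cases j
  · refine (hd.fun_mul (he 1 1)).congr_deriv ?_
    simp
    field_simp
    ring
  · refine (hd.fun_mul (he 0 1).fun_neg).congr_deriv ?_
    simp
    field_simp
    ring
  · refine (hd.fun_mul (he 1 0).fun_neg).congr_deriv ?_
    simp
    field_simp
    ring
  · refine (hd.fun_mul (he 0 0)).congr_deriv ?_
    simp
    field_simp
    ring

/-- The derivative `∂g/∂u^k` of the family. -/
def familySlope (c : Fin 2 → ℝ) (k : Fin 2) : Matrix (Fin 2) (Fin 2) ℝ :=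
  Matrix.of fun i j => (1 / 2) * (c i * (if j = k then 1 else 0) + c j * if i = k then 1 else 0)

variable (c₁ c₂ c₃ c₄ c₅ : ℝ)

theorem familyMetric_add (u : Fin 2 → ℝ) (k : Fin 2) (t : ℝ) :
    familyMetric c₁ c₂ c₃ c₄ c₅ (u + t • Pi.single k 1) =
      familyMetric c₁ c₂ c₃ c₄ c₅ u + t • familySlope ![c₁, c₃] k := by
  ext i j
  fin_cases k <;> fin_cases i <;> fin_cases j <;> simp [familyMetric, familySlope] <;> ring

theorem partialU_inv_familyMetric {u : Fin 2 → ℝ}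
    (hu : (familyMetric c₁ c₂ c₃ c₄ c₅ u).det ≠ 0) (k i j : Fin 2) :
    partialU k (fun v => (familyMetric c₁ c₂ c₃ c₄ c₅ v)⁻¹ i j) u =
      -((familyMetric c₁ c₂ c₃ c₄ c₅ u)⁻¹ * familySlope ![c₁, c₃] k *
        (familyMetric c₁ c₂ c₃ c₄ c₅ u)⁻¹) i j := by
  simp only [partialU, lineDeriv, familyMetric_add]
  exact (hasDerivAt_inv_add_smul _ _ hu i j).deriv

/-- The Levi-Civita connection of the family is `Γ^i_{jk} = -c^i g_{jk} / 2`. -/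
theorem christoffel_familyMetric {u : Fin 2 → ℝ}
    (hu : (familyMetric c₁ c₂ c₃ c₄ c₅ u).det ≠ 0) (i j k : Fin 2) :
    christoffel (familyMetric c₁ c₂ c₃ c₄ c₅) i j k u =
      -(1 / 2) * (![c₁, c₃] i * (familyMetric c₁ c₂ c₃ c₄ c₅ u)⁻¹ j k) := by
  simp only [christoffel, partialU_inv_familyMetric _ _ _ _ _ hu]
  obtain ⟨a, b, d, hM⟩ : ∃ a b d, familyMetric c₁ c₂ c₃ c₄ c₅ u = !![a, b; b, d] := ⟨_, _, _, rfl⟩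
  have hd : a * d - b ^ 2 ≠ 0 := by
    rw [hM, Matrix.det_fin_two_of] at hu
    rwa [sq]
  simp only [hM, Matrix.inv_def, Ring.inverse_eq_inv', Matrix.det_fin_two_of,
    Matrix.adjugate_fin_two_of, Matrix.smul_apply, Matrix.mul_apply,
    Fin.sum_univ_two, smul_eq_mul, familySlope, Matrix.of_apply]
  fin_cases i <;> fin_cases j <;> fin_cases k <;> simp <;> field_simp <;> ring

/-- `-g^{il} Γ^j_{lk} = δ^i_k c^j / 2`. -/
theorem contraChristoffel_familyMetric {u : Fin 2 → ℝ}
    (hu : (familyMetric c₁ c₂ c₃ c₄ c₅ u).det ≠ 0) (i j k : Fin 2) :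
    contraChristoffel (familyMetric c₁ c₂ c₃ c₄ c₅) u i j k =
      if i = k then (1 / 2) * ![c₁, c₃] j else 0 := by
  have h := congrFun₂ (Matrix.mul_nonsing_inv _ hu.isUnit) i k
  rw [Matrix.mul_apply, Matrix.one_apply] at h
  simp only [contraChristoffel, christoffel_familyMetric _ _ _ _ _ hu]
  calc -∑ l, familyMetric c₁ c₂ c₃ c₄ c₅ u i l *
        (-(1 / 2) * (![c₁, c₃] j * (familyMetric c₁ c₂ c₃ c₄ c₅ u)⁻¹ l k))
      = (1 / 2) * ![c₁, c₃] j * ∑ l, familyMetric c₁ c₂ c₃ c₄ c₅ u i l *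
        (familyMetric c₁ c₂ c₃ c₄ c₅ u)⁻¹ l k := by
        rw [Fin.sum_univ_two, Fin.sum_univ_two]
        ring
    _ = _ := by rw [h, mul_ite, mul_one, mul_zero]

theorem continuous_familyMetric : Continuous (familyMetric c₁ c₂ c₃ c₄ c₅) := by
  refine continuous_matrix fun i j => ?_
  fin_cases i <;> fin_cases j <;> simp [familyMetric] <;> fun_prop

/-- The derivative terms `-(1/2) c^i (∂_k g_{lj} - ∂_l g_{kj})` of the curvature cancel against the
quadratic ones. -/
theorem curvature_familyMetric {u : Fin 2 → ℝ}
    (hu : (familyMetric c₁ c₂ c₃ c₄ c₅ u).det ≠ 0) (i j k l : Fin 2) :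
    curvature (familyMetric c₁ c₂ c₃ c₄ c₅) i j k l u = 0 := by
  have hnear : ∀ᶠ v in nhds u, (familyMetric c₁ c₂ c₃ c₄ c₅ v).det ≠ 0 :=
    (continuous_familyMetric c₁ c₂ c₃ c₄ c₅).matrix_det.continuousAt.eventually_ne hu
  have hp : ∀ k l j, partialU k (christoffel (familyMetric c₁ c₂ c₃ c₄ c₅) i l j) u =
      (1 / 2) * (![c₁, c₃] i * ((familyMetric c₁ c₂ c₃ c₄ c₅ u)⁻¹ * familySlope ![c₁, c₃] k *
        (familyMetric c₁ c₂ c₃ c₄ c₅ u)⁻¹) l j) := by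
    intro k l j
    have he : christoffel (familyMetric c₁ c₂ c₃ c₄ c₅) i l j =ᶠ[nhds u]
        fun v => -(1 / 2) * (![c₁, c₃] i * (familyMetric c₁ c₂ c₃ c₄ c₅ v)⁻¹ l j) := by
      filter_upwards [hnear] with v hv
      exact christoffel_familyMetric _ _ _ _ _ hv i l j
    rw [partialU, he.lineDeriv_eq]
    simp only [lineDeriv, familyMetric_add]
    rw [(((hasDerivAt_inv_add_smul _ _ hu l j).const_mul _).const_mul _).deriv]
    ring
  have hsymm : (familyMetric c₁ c₂ c₃ c₄ c₅ u)⁻¹ 1 0 = (familyMetric c₁ c₂ c₃ c₄ c₅ u)⁻¹ 0 1 := by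
    simp [Matrix.inv_def, Matrix.adjugate_fin_two, familyMetric]
  simp only [curvature, hp, christoffel_familyMetric _ _ _ _ _ hu]
  generalize (familyMetric c₁ c₂ c₃ c₄ c₅ u)⁻¹ = h at hsymm
  simp only [Matrix.mul_apply, Fin.sum_univ_two, familySlope, Matrix.of_apply]
  fin_cases k <;> fin_cases l <;> fin_cases j <;> simp [hsymm] <;> ring

/-! ### Operators compatible with the second-order operator -/

theorem christoffel_congr {g g' : (Fin 2 → ℝ) → Matrix (Fin 2) (Fin 2) ℝ}
    (h : ∀ u ∈ U, g u = g' u) {u : Fin 2 → ℝ} (hu : u ∈ U) (i j k : Fin 2) :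
    christoffel g i j k u = christoffel g' i j k u := by
  have hp : ∀ k i j, partialU k (fun v => (g v)⁻¹ i j) u =
      partialU k (fun v => (g' v)⁻¹ i j) u := by
    intro k i j
    refine Filter.EventuallyEq.lineDeriv_eq ?_
    filter_upwards [U.isOpen.mem_nhds hu] with v hv
    rw [h v hv]
  simp only [christoffel, hp, h u hu]

variable {c₁ c₂ c₃ c₄ c₅}

theorem isHamiltonian_of_familyMetric {g : (Fin 2 → ℝ) → Matrix (Fin 2) (Fin 2) ℝ}
    {Γ : (Fin 2 → ℝ) → Fin 2 → Fin 2 → Fin 2 → ℝ}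
    (hg : ∀ u ∈ U, g u = familyMetric c₁ c₂ c₃ c₄ c₅ u)
    (hΓ : ∀ u ∈ U, ∀ i j k, Γ u i j k = if i = k then (1 / 2) * ![c₁, c₃] j else 0) (s t : ℝ) :
    IsHamiltonian U (s • hydroOp g Γ + t • R2) := by
  refine (RepOp.isHamiltonian_iff (repOp_pencil s t (fun i j p hp => ?_) fun i j k p hp => ?_)).2
    ((diffCalculus U).isPoisson_pencil s t (fun i => (1 / 2) * ![c₁, c₃] i)
      !![c₂, c₅; c₅, c₄] rfl)
  · have hc : ∀ i, evalAt ⟨p, hp⟩ ((diffCalculus U).coord 0 i) = p.val i := fun _ => rfl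
    refine (congrFun₂ (hg _ hp) i j).trans ?_
    fin_cases i <;> fin_cases j <;> simp [hc, familyMetric] <;> ring
  · refine (hΓ _ hp i j k).trans ?_
    by_cases h : i = k <;> simp [h]

/-- A jet with value `u`. -/
def pointOver {u : Fin 2 → ℝ} (hu : u ∈ U) : JetOver U := ⟨(0, fun a => u a.2), hu⟩

theorem eq_const_of_pd_eq_zero (hU : IsPreconnected (U : Set (Fin 2 → ℝ)))
    {G : (Fin 2 → ℝ) → ℝ} (hG : ContDiffOn ℝ ∞ G U)
    (h : ∀ k, (diffCalculus U).pd 0 k (ofFun G hG) = 0) : ∃ c, ∀ u ∈ U, G u = c := by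
  refine U.isOpen.exists_is_const_of_fderiv_eq_zero hU (hG.differentiableOn (by simp)) ?_
  intro u hu
  have hd : DifferentiableAt ℝ G u :=
    (hG.contDiffAt (U.isOpen.mem_nhds hu)).differentiableAt (by simp)
  have hk : ∀ k, fderiv ℝ G u (Pi.single k 1) = 0 := fun k => by
    have h1 := congrArg (evalAt (pointOver hu)) (h k)
    rw [evalAt_pd_zero_ofFun, map_zero] at h1
    exact hd.lineDeriv_eq_fderiv.symm.trans h1
  refine ContinuousLinearMap.coe_injective (LinearMap.pi_ext' fun k => LinearMap.ext_ring ?_)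
  simpa using hk k

theorem familyMetric_of_isHamiltonian (hU : IsPreconnected (U : Set (Fin 2 → ℝ)))
    {g : (Fin 2 → ℝ) → Matrix (Fin 2) (Fin 2) ℝ} {Γ : (Fin 2 → ℝ) → Fin 2 → Fin 2 → Fin 2 → ℝ}
    (hg : ∀ i j, ContDiffOn ℝ ∞ (fun u => g u i j) U)
    (hΓ : ∀ i j k, ContDiffOn ℝ ∞ (fun u => Γ u i j k) U)
    (h : Compatible U (hydroOp g Γ) R2) :
    ∃ c₁ c₂ c₃ c₄ c₅ : ℝ, (∀ u ∈ U, g u = familyMetric c₁ c₂ c₃ c₄ c₅ u) ∧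
      ∀ u ∈ U, ∀ i j k, Γ u i j k = if i = k then (1 / 2) * ![c₁, c₃] j else 0 := by
  set g' : Fin 2 → Fin 2 → DiffFun U := fun i j => ofFun _ (hg i j) with hg'
  set Γ' : Fin 2 → Fin 2 → Fin 2 → DiffFun U := fun i j k => ofFun _ (hΓ i j k) with hΓ'
  have hrep := fun s t : ℝ => repOp_pencil s t (g := g) (Γ := Γ) (g' := g') (Γ' := Γ')
    (fun i j => rep_ofFun _ (hg i j)) (fun i j k => rep_ofFun _ (hΓ i j k))
  have hP : (diffCalculus U).IsPoisson ((diffCalculus U).hydro g' Γ') := by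
    have h1 := (hrep 1 0).isHamiltonian_iff.1 (h 1 0)
    have h2 : (diffCalculus U).pencil 1 0 g' Γ' = (diffCalculus U).hydro g' Γ' := by
      funext φ i
      rw [JetCalculus.pencil, one_smul, zero_smul, add_zero]
    rwa [h2] at h1
  obtain ⟨hsymm, hpd, hΓg, hconst⟩ := (diffCalculus U).conditions_of_isPoisson
    (fun i j k l => pd_succ_ofFun _ _ k l) (fun i j m k l => pd_succ_ofFun _ _ k l) hP
    ((hrep 1 1).isHamiltonian_iff.1 (h 1 1))
  have hsl : ∀ j, ∃ c : ℝ, (diffCalculus U).pd 0 j (g' j j) = algebraMap ℝ _ c := by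
    intro j
    have hs : ContDiffOn ℝ ∞ (partialU j fun u => g u j j) U := by
      refine (((hg j j).fderiv_of_isOpen (m := ∞) U.isOpen (by simp)).clm_apply
        (contDiffOn_const (c := Pi.single j 1))).congr fun u hu => ?_
      exact (((hg j j).contDiffAt (U.isOpen.mem_nhds hu)).differentiableAt
        (by simp)).lineDeriv_eq_fderiv
    have he : (diffCalculus U).pd 0 j (g' j j) = ofFun _ hs :=
      ext_evalAt fun p => evalAt_pd_zero_ofFun _ _ j p
    obtain ⟨c, hc⟩ := eq_const_of_pd_eq_zero hU hs fun k => he ▸ hconst j k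
    exact ⟨c, he.trans (ext_evalAt fun p => hc _ p.2)⟩
  choose c hc using hsl
  have hη : ∀ i j, ∃ η : ℝ, ∀ u ∈ U, g u i j = (1 / 2) * (c j * u i + c i * u j) + η := by
    intro i j
    have hs : ContDiffOn ℝ ∞ (fun u => g u i j - (1 / 2) * (c j * u i + c i * u j)) U :=
      (hg i j).sub (by fun_prop)
    have he : ofFun _ hs = g' i j - ((1 / 2 * c j) • (diffCalculus U).coord 0 i +
        (1 / 2 * c i) • (diffCalculus U).coord 0 j) := ext_evalAt fun p => by
      have hcoord : ∀ i, evalAt p ((diffCalculus U).coord 0 i) = p.1.val i := fun _ => rfl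
      have hG : ∀ {G : (Fin 2 → ℝ) → ℝ} (hG : ContDiffOn ℝ ∞ G U),
        evalAt p (ofFun G hG) = G p.1.val := fun _ => rfl
      simp only [map_sub, map_add, map_smul, hcoord, hg', hG, smul_eq_mul]
      ring
    obtain ⟨η, hη⟩ := eq_const_of_pd_eq_zero hU hs fun k => by
      rw [he, map_sub, map_add, Derivation.map_smul, Derivation.map_smul, hpd i j k, hc, hc,
        (diffCalculus U).pd_coord, (diffCalculus U).pd_coord]
      by_cases hi : i = k <;> by_cases hj : j = k <;>
        simp [hi, hj, eq_comm (a := k), Algebra.smul_def]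
    exact ⟨η, fun u hu => by linear_combination hη u hu⟩
  choose η hη using hη
  refine ⟨c 0, η 0 0, c 1, η 1 1, η 0 1, fun u hu => ?_, fun u hu i j k => ?_⟩
  · have h10 : g u 1 0 = g u 0 1 := congrArg (evalAt (pointOver hu)) (hsymm 1 0)
    have h00 := hη 0 0 u hu
    have h01 := hη 0 1 u hu
    have h11 := hη 1 1 u hu
    ext i j
    fin_cases i <;> fin_cases j <;> simp [familyMetric, h00, h01, h11, h10] <;> ring
  · have h1 : Γ u i j k = _ := congrArg (evalAt (pointOver hu)) (hΓg i j k)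
    rw [h1, hc]
    have : ![c 0, c 1] j = c j := by fin_cases j <;> rfl
    rw [this]
    by_cases hi : i = k <;> simp [hi]

end LocalPoisson

end

theorem theorem1 :
    (∀ U : Set (Fin 2 → ℝ), IsOpen U → IsConnected U →
      ∀ g : (Fin 2 → ℝ) → Matrix (Fin 2) (Fin 2) ℝ,
        (∀ i j, ContDiffOn ℝ ∞ (fun u => g u i j) U) →
        ((∃ Γ : (Fin 2 → ℝ) → Fin 2 → Fin 2 → Fin 2 → ℝ,
            (∀ i j k, ContDiffOn ℝ ∞ (fun u => Γ u i j k) U) ∧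
            LocalPoisson.IsHamiltonian U (LocalPoisson.hydroOp g Γ) ∧
            LocalPoisson.Compatible U (LocalPoisson.hydroOp g Γ) LocalPoisson.R2) ↔
          ∃ c₁ c₂ c₃ c₄ c₅ : ℝ, ∀ u ∈ U,
            g u = LocalPoisson.familyMetric c₁ c₂ c₃ c₄ c₅ u)) ∧
    (∀ U : Set (Fin 2 → ℝ), IsOpen U → IsConnected U →
      ∀ (g : (Fin 2 → ℝ) → Matrix (Fin 2) (Fin 2) ℝ)
        (Γ : (Fin 2 → ℝ) → Fin 2 → Fin 2 → Fin 2 → ℝ),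
        (∀ i j, ContDiffOn ℝ ∞ (fun u => g u i j) U) →
        (∀ i j k, ContDiffOn ℝ ∞ (fun u => Γ u i j k) U) →
        (∀ u ∈ U, (g u).det ≠ 0) →
        ((LocalPoisson.IsHamiltonian U (LocalPoisson.hydroOp g Γ) ∧
            LocalPoisson.Compatible U (LocalPoisson.hydroOp g Γ) LocalPoisson.R2) ↔
          (∃ c₁ c₂ c₃ c₄ c₅ : ℝ, ∀ u ∈ U,
            g u = LocalPoisson.familyMetric c₁ c₂ c₃ c₄ c₅ u) ∧
          ∀ u ∈ U, ∀ i j k, Γ u i j k = LocalPoisson.contraChristoffel g u i j k)) ∧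
    (∀ (c₁ c₂ c₃ c₄ c₅ : ℝ) (u : Fin 2 → ℝ),
      (LocalPoisson.familyMetric c₁ c₂ c₃ c₄ c₅ u).det ≠ 0 →
      ∀ i j k l, LocalPoisson.curvature (LocalPoisson.familyMetric c₁ c₂ c₃ c₄ c₅) i j k l u = 0) := by
  have hcontra : ∀ {U : Set (Fin 2 → ℝ)}, IsOpen U →
      ∀ {g : (Fin 2 → ℝ) → Matrix (Fin 2) (Fin 2) ℝ} {c₁ c₂ c₃ c₄ c₅ : ℝ},
      (∀ u ∈ U, g u = LocalPoisson.familyMetric c₁ c₂ c₃ c₄ c₅ u) →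
      ∀ u ∈ U, (g u).det ≠ 0 → ∀ i j k, LocalPoisson.contraChristoffel g u i j k =
        if i = k then (1 / 2) * ![c₁, c₃] j else 0 := by
    intro U hU g c₁ c₂ c₃ c₄ c₅ hg u hu hdet i j k
    rw [hg u hu] at hdet
    rw [← LocalPoisson.contraChristoffel_familyMetric _ _ _ _ _ hdet]
    simp only [LocalPoisson.contraChristoffel, hg u hu,
      LocalPoisson.christoffel_congr (U := ⟨U, hU⟩) hg hu]
  have hsuff : ∀ {U : Set (Fin 2 → ℝ)}, IsOpen U →
      ∀ {g : (Fin 2 → ℝ) → Matrix (Fin 2) (Fin 2) ℝ}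
        {Γ : (Fin 2 → ℝ) → Fin 2 → Fin 2 → Fin 2 → ℝ} {c₁ c₂ c₃ c₄ c₅ : ℝ},
      (∀ u ∈ U, g u = LocalPoisson.familyMetric c₁ c₂ c₃ c₄ c₅ u) →
      (∀ u ∈ U, ∀ i j k, Γ u i j k = if i = k then (1 / 2) * ![c₁, c₃] j else 0) →
      LocalPoisson.IsHamiltonian U (LocalPoisson.hydroOp g Γ) ∧
        LocalPoisson.Compatible U (LocalPoisson.hydroOp g Γ) LocalPoisson.R2 := by
    intro U hU g Γ c₁ c₂ c₃ c₄ c₅ hg hΓ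
    have h := LocalPoisson.isHamiltonian_of_familyMetric (U := ⟨U, hU⟩) hg hΓ
    have h1 := h 1 0
    rw [one_smul, zero_smul, add_zero] at h1
    exact ⟨h1, h⟩
  refine ⟨fun U hU hUc g hg => ⟨?_, ?_⟩, fun U hU hUc g Γ hg hΓ hdet => ⟨?_, ?_⟩, ?_⟩
  · rintro ⟨Γ, hΓ, -, h⟩
    obtain ⟨c₁, c₂, c₃, c₄, c₅, h, -⟩ := LocalPoisson.familyMetric_of_isHamiltonian
      (U := ⟨U, hU⟩) hUc.isPreconnected hg hΓ h
    exact ⟨c₁, c₂, c₃, c₄, c₅, h⟩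
  · rintro ⟨c₁, c₂, c₃, c₄, c₅, h⟩
    exact ⟨fun _ i j k => if i = k then (1 / 2) * ![c₁, c₃] j else 0,
      fun i j k => contDiffOn_const, hsuff hU h fun _ _ _ _ _ => rfl⟩
  · rintro ⟨-, h⟩
    obtain ⟨c₁, c₂, c₃, c₄, c₅, h, h'⟩ := LocalPoisson.familyMetric_of_isHamiltonian
      (U := ⟨U, hU⟩) hUc.isPreconnected hg hΓ h
    exact ⟨⟨c₁, c₂, c₃, c₄, c₅, h⟩, fun u hu i j k => by
      rw [h' u hu, hcontra hU h u hu (hdet u hu)]⟩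
  · rintro ⟨⟨c₁, c₂, c₃, c₄, c₅, h⟩, h'⟩
    exact hsuff hU h fun u hu i j k => by rw [h' u hu, hcontra hU h u hu (hdet u hu)]
  · intro c₁ c₂ c₃ c₄ c₅ u hu i j k l
    exact LocalPoisson.curvature_familyMetric _ _ _ _ _ hu i j k l
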